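/- Let $L>0$, let $a\in L^\infty(0,L)$ be such that, for some constants $0<\alpha<\beta$, $\alpha\le a(x)\le\beta$ for a.e. $x\in(0,L)$, and let $g\in L^2(0,L)$. Let $\phi:\mathbb{R}\to\mathbb{R}\cup\{+\infty\}$ be continuous (with values in $\mathbb{R}\cup\{+\infty\}$), with $\phi(s)<+\infty$ for every $s\neq 0$ and $\phi(0)=+\infty$. The space $H^1_0(0,L)$ consists of the $z\in L^2(0,L)$ with distributional derivative $z'\in L^2(0,L)$ and $z(0)=z(L)=0$, and is normed by $\|z'\|_{L^2(0,L)}$. Suppose that the singular problem for the data $(a,g,\phi)$ has a weak solution, i.e. that there is $u\in H^1_0(0,L)$ with $\phi(u)\in L^2(0,L)$ and $$-\frac{d}{dx}\Big(a(x)\frac{du}{dx}\Big)=-\frac{d\phi(u)}{dx}-\frac{dg}{dx}\quad\text{in }\mathcal D'(0,L).$$ Let $(\phi_n)_{n\in\mathbb N}$ be a sequence of bounded continuous functions $\phi_n:\mathbb{R}\to\mathbb{R}$ that is a reasonable approximation of $\phi$: for every sequence $s_n\in\mathbb{R}$ and every $s\in\mathbb{R}$ with $s_n\to s$, one has $\phi_n(s_n)\to\phi(s)$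 in $\mathbb{R}\cup\{+\infty\}$. Then there exist a strictly increasing sequence of indices $(n_j)_{j\in\mathbb{N}}$ and functions $g_j\in L^2(0,L)$ with $g_j\to g$ strongly in $L^2(0,L)$ such that: 1. for every $j$, the approximating problem $$u_j\in H^1_0(0,L),\qquad -\frac{d}{dx}\Big(a(x)\frac{du_j}{dx}\Big)=-\frac{d\phi_{n_j}(u_j)}{dx}-\frac{dg_j}{dx}\quad\text{in }\mathcal D'(0,L)$$ has at least one solution $u_j$ (a classical weak solution); 2. for every choice, for each $j$, of a solution $u_j$ of this problem, one has $u_j\rightharpoonup 0$ weakly in $H^1_0(0,L)$ as $j\to\infty$. -/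

import Mathlib

open MeasureTheory Filter Topology Set
open scoped BoundedContinuousFunction

/-- The open interval `(0, L)` as an open subset of the line. -/
def openInterval (L : ℝ) : TopologicalSpace.Opens ℝ := ⟨Ioo 0 L, isOpen_Ioo⟩

/-- The test functions `C_c^∞(0, L)`. -/
abbrev TestFn (L : ℝ) := TestFunction (openInterval L) ℝ ⊤

/-- The space `L²(0, L)` of real functions. -/
noncomputable abbrev L2 (L : ℝ) := Lp ℝ 2 (volume.restrict (Ioo 0 L))

/-- The space `L^∞(0, L)` of real functions. -/
noncomputable abbrev Linf (L : ℝ) := Lp ℝ ⊤ (volume.restrict (Ioo 0 L))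

/-- `v` is the distributional derivative of `u` on `(0, L)`. -/
def IsWeakDeriv (L : ℝ) (u v : ℝ → ℝ) : Prop :=
  ∀ ψ : TestFn L, ∫ x in Ioo 0 L, u x * deriv ψ x = - ∫ x in Ioo 0 L, v x * ψ x

/-- `u` has a representative that is continuous on `[0, L]` and vanishes at both end points. -/
def VanishesAtEndpoints (L : ℝ) (u : ℝ → ℝ) : Prop :=
  ∃ w : ℝ → ℝ, ContinuousOn w (Icc 0 L) ∧ w 0 = 0 ∧ w L = 0 ∧
    u =ᵐ[volume.restrict (Ioo 0 L)] w

theorem TestFn.memLp_two {L : ℝ} (ψ : TestFn L) :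
    MemLp (ψ : ℝ → ℝ) 2 (volume.restrict (Ioo 0 L)) :=
  (ψ.continuous.memLp_of_hasCompactSupport ψ.hasCompactSupport).restrict _

theorem TestFn.contDiff_deriv {L : ℝ} (ψ : TestFn L) :
    ContDiff ℝ ((⊤ : ℕ∞) : WithTop ℕ∞) (deriv (ψ : ℝ → ℝ)) :=
  (contDiff_infty_iff_deriv.1 ψ.contDiff).2

theorem TestFn.memLp_two_deriv {L : ℝ} (ψ : TestFn L) :
    MemLp (deriv (ψ : ℝ → ℝ)) 2 (volume.restrict (Ioo 0 L)) :=
  (ψ.contDiff_deriv.continuous.memLp_of_hasCompactSupport ψ.hasCompactSupport.deriv).restrict _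

theorem integrable_mul_of_L2 {L : ℝ} (u : L2 L) {f : ℝ → ℝ}
    (hf : MemLp f 2 (volume.restrict (Ioo 0 L))) :
    Integrable (fun x => u x * f x) (volume.restrict (Ioo 0 L)) :=
  (Lp.memLp u).integrable_mul hf

/-- `H^1_0(0, L)`, as the space of pairs `(u, u')` in `L² × L²` where `u'` is the distributional
derivative of `u` and `u` vanishes at the end points. -/
def H10Submodule (L : ℝ) : Submodule ℝ (L2 L × L2 L) where
  carrier := {p | IsWeakDeriv L p.1 p.2 ∧ VanishesAtEndpoints L p.1}
  zero_mem' := by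
    have h0 : ((0 : L2 L) : ℝ → ℝ) =ᵐ[volume.restrict (Ioo 0 L)] 0 := Lp.coeFn_zero _ _ _
    refine ⟨fun ψ => ?_, 0, continuousOn_const, rfl, rfl, h0⟩
    have e1 : ∫ x in Ioo 0 L, (0 : L2 L) x * deriv ψ x = 0 :=
      integral_eq_zero_of_ae (by filter_upwards [h0] with x hx; rw [hx]; simp)
    have e2 : ∫ x in Ioo 0 L, (0 : L2 L) x * ψ x = 0 :=
      integral_eq_zero_of_ae (by filter_upwards [h0] with x hx; rw [hx]; simp)
    change ∫ x in Ioo 0 L, (0 : L2 L) x * deriv ψ x = - ∫ x in Ioo 0 L, (0 : L2 L) x * ψ x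
    rw [e1, e2, neg_zero]
  add_mem' := by
    rintro ⟨u, v⟩ ⟨u', v'⟩ ⟨h, w, hw, hw0, hwL, hu⟩ ⟨h', w', hw', hw0', hwL', hu'⟩
    dsimp only at h h' hu hu'
    have a1 : ((u + u' : L2 L) : ℝ → ℝ) =ᵐ[volume.restrict (Ioo 0 L)] u + u' := Lp.coeFn_add _ _
    have a2 : ((v + v' : L2 L) : ℝ → ℝ) =ᵐ[volume.restrict (Ioo 0 L)] v + v' := Lp.coeFn_add _ _
    refine ⟨fun ψ => ?_, w + w', hw.add hw', by simp [hw0, hw0'], by simp [hwL, hwL'], ?_⟩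
    · change ∫ x in Ioo 0 L, (u + u' : L2 L) x * deriv ψ x
        = - ∫ x in Ioo 0 L, (v + v' : L2 L) x * ψ x
      have e1 : ∫ x in Ioo 0 L, (u + u' : L2 L) x * deriv ψ x
          = ∫ x in Ioo 0 L, (u x * deriv ψ x + u' x * deriv ψ x) :=
        integral_congr_ae (by filter_upwards [a1] with x hx; rw [hx, Pi.add_apply, add_mul])
      have e2 : ∫ x in Ioo 0 L, (v + v' : L2 L) x * ψ x
          = ∫ x in Ioo 0 L, (v x * ψ x + v' x * ψ x) :=
        integral_congr_ae (by filter_upwards [a2] with x hx; rw [hx, Pi.add_apply, add_mul])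
      rw [e1, e2, integral_add (integrable_mul_of_L2 u ψ.memLp_two_deriv)
        (integrable_mul_of_L2 u' ψ.memLp_two_deriv), integral_add (integrable_mul_of_L2 v ψ.memLp_two)
        (integrable_mul_of_L2 v' ψ.memLp_two), h ψ, h' ψ]
      ring
    · exact a1.trans (hu.add hu')
  smul_mem' := by
    rintro c ⟨u, v⟩ ⟨h, w, hw, hw0, hwL, hu⟩
    dsimp only at h hu
    have a1 : ((c • u : L2 L) : ℝ → ℝ) =ᵐ[volume.restrict (Ioo 0 L)] c • u := Lp.coeFn_smul _ _
    have a2 : ((c • v : L2 L) : ℝ → ℝ) =ᵐ[volume.restrict (Ioo 0 L)] c • v := Lp.coeFn_smul _ _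
    refine ⟨fun ψ => ?_, c • w, hw.const_smul c, by simp [hw0], by simp [hwL], ?_⟩
    · change ∫ x in Ioo 0 L, (c • u : L2 L) x * deriv ψ x
        = - ∫ x in Ioo 0 L, (c • v : L2 L) x * ψ x
      have e1 : ∫ x in Ioo 0 L, (c • u : L2 L) x * deriv ψ x
          = ∫ x in Ioo 0 L, c * (u x * deriv ψ x) :=
        integral_congr_ae (by filter_upwards [a1] with x hx; rw [hx, Pi.smul_apply, smul_eq_mul, mul_assoc])
      have e2 : ∫ x in Ioo 0 L, (c • v : L2 L) x * ψ x
          = ∫ x in Ioo 0 L, c * (v x * ψ x) :=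
        integral_congr_ae (by filter_upwards [a2] with x hx; rw [hx, Pi.smul_apply, smul_eq_mul, mul_assoc])
      rw [e1, e2, integral_const_mul, integral_const_mul, h ψ]
      ring
    · exact a1.trans (hu.const_smul c)

/-- The Sobolev space `H^1_0(0, L)`. -/
def H10 (L : ℝ) : Type := H10Submodule L

noncomputable instance (L : ℝ) : AddCommGroup (H10 L) :=
  inferInstanceAs (AddCommGroup (H10Submodule L))

noncomputable instance (L : ℝ) : Module ℝ (H10 L) :=
  inferInstanceAs (Module ℝ (H10Submodule L))

/-- The underlying `L²` function of an element of `H^1_0(0, L)`. -/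
noncomputable def H10.toL2 {L : ℝ} : H10 L →ₗ[ℝ] L2 L :=
  (LinearMap.fst ℝ (L2 L) (L2 L)).comp (H10Submodule L).subtype

/-- The distributional derivative of an element of `H^1_0(0, L)`. -/
noncomputable def H10.deriv {L : ℝ} : H10 L →ₗ[ℝ] L2 L :=
  (LinearMap.snd ℝ (L2 L) (L2 L)).comp (H10Submodule L).subtype

/-- A continuous function on `[0, L]` that vanishes at `0` and has distributional derivative zero
vanishes on `(0, L)`. -/
theorem eq_zero_of_weakDeriv_zero {L : ℝ} {w : ℝ → ℝ} (hw : ContinuousOn w (Icc 0 L))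
    (hw0 : w 0 = 0) (h : ∀ ψ : TestFn L, ∫ x in Ioo 0 L, w x * deriv ψ x = 0) :
    ∀ x ∈ Ioo 0 L, w x = 0 := by
  intro x₀ hx₀
  have hL : 0 < L := hx₀.1.trans hx₀.2
  -- a test function with integral one
  let b : ContDiffBump (L / 2) := ⟨L / 8, L / 4, by positivity, by linarith⟩
  let η : ℝ → ℝ := b.normed volume
  have hηs : ContDiff ℝ ((⊤ : ℕ∞) : WithTop ℕ∞) η := b.contDiff_normed
  have hηt : tsupport η ⊆ Icc (L / 4) (3 * L / 4) := by
    rw [show tsupport η = _ from b.tsupport_normed_eq, Real.closedBall_eq_Icc]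
    apply Icc_subset_Icc <;> simp [b] <;> linarith
  have hηc : HasCompactSupport η := b.hasCompactSupport_normed
  have hη1 : ∫ x, η x = 1 := b.integral_normed
  let c : ℝ := ∫ x in Ioo 0 L, w x * η x
  have hwint : IntegrableOn w (Ioo 0 L) :=
    (hw.integrableOn_Icc).mono_set Ioo_subset_Icc_self
  have hmul : ∀ f : ℝ → ℝ, Continuous f → HasCompactSupport f →
      Integrable (fun x => w x * f x) (volume.restrict (Ioo 0 L)) := by
    intro f hf hfc
    obtain ⟨C, hC⟩ := hf.bounded_above_of_compact_support hfc
    exact hwint.mul_bdd hf.aestronglyMeasurable (ae_of_all _ hC)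
  -- the primitive of a test function with integral zero is a test function
  have hprim : ∀ χ : ℝ → ℝ, ContDiff ℝ ((⊤ : ℕ∞) : WithTop ℕ∞) χ → HasCompactSupport χ →
      tsupport χ ⊆ Ioo 0 L → ∫ x in Ioo 0 L, χ x * (w x - c) = 0 := by
    intro χ hχ hχc hχt
    let I : ℝ := ∫ x, χ x
    let ξ : ℝ → ℝ := fun x => χ x - I * η x
    have hξ : ContDiff ℝ ((⊤ : ℕ∞) : WithTop ℕ∞) ξ := hχ.sub (contDiff_const.mul hηs)
    obtain ⟨p, q, hp, hpq, hq, hsub⟩ : ∃ p q : ℝ, 0 < p ∧ p ≤ q ∧ q < L ∧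
        ∀ x, x ∉ Icc p q → ξ x = 0 := by
      have hK : IsCompact (tsupport χ ∪ Icc (L / 4) (3 * L / 4)) := hχc.isCompact.union isCompact_Icc
      have hne : (tsupport χ ∪ Icc (L / 4) (3 * L / 4)).Nonempty :=
        ⟨L / 4, Or.inr ⟨le_rfl, by linarith⟩⟩
      have hKs : tsupport χ ∪ Icc (L / 4) (3 * L / 4) ⊆ Ioo 0 L :=
        union_subset hχt (fun x hx => ⟨by linarith [hx.1], by linarith [hx.2]⟩)
      refine ⟨sInf _, sSup _, (hKs (hK.sInf_mem hne)).1, ?_, (hKs (hK.sSup_mem hne)).2, ?_⟩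
      · exact Real.sInf_le_sSup _ hK.bddBelow hK.bddAbove
      · intro x hx
        have hx' : x ∉ tsupport χ ∪ Icc (L / 4) (3 * L / 4) := fun hm =>
          hx ⟨csInf_le hK.bddBelow hm, le_csSup hK.bddAbove hm⟩
        have h1 : χ x = 0 := image_eq_zero_of_notMem_tsupport fun hm => hx' (Or.inl hm)
        have h2 : η x = 0 := image_eq_zero_of_notMem_tsupport fun hm => hx' (Or.inr (hηt hm))
        simp [ξ, h1, h2]
    have hχi : Integrable χ := hχ.continuous.integrable_of_hasCompactSupport hχc
    have hηi : Integrable η := hηs.continuous.integrable_of_hasCompactSupport hηc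
    have hξ0 : ∫ x, ξ x = 0 := by
      simp only [ξ]
      rw [integral_sub hχi (hηi.const_mul I), integral_const_mul, hη1]
      simp [I]
    have hξi : Integrable ξ := hχi.sub (hηi.const_mul I)
    let Ψ : ℝ → ℝ := fun x => ∫ t in (0 : ℝ)..x, ξ t
    have hΨd : ∀ x, HasDerivAt Ψ (ξ x) x := fun x =>
      intervalIntegral.integral_hasDerivAt_right (hξ.continuous.intervalIntegrable _ _)
        (hξ.continuous.stronglyMeasurableAtFilter _ _) hξ.continuous.continuousAt
    have hΨ' : deriv Ψ = ξ := funext fun x => (hΨd x).deriv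
    have hΨ : ContDiff ℝ ((⊤ : ℕ∞) : WithTop ℕ∞) Ψ :=
      contDiff_infty_iff_deriv.2 ⟨fun x => (hΨd x).differentiableAt, hΨ' ▸ hξ⟩
    have hΨ0 : ∀ x, x ∉ Icc p q → Ψ x = 0 := by
      intro x hx
      by_cases hxp : x < p
      · apply intervalIntegral.integral_zero_ae
        refine ae_of_all _ fun t ht => hsub t fun ht' => ?_
        rcases uIoc_subset_uIcc ht with ⟨_, h2⟩
        have : max 0 x < p := max_lt hp hxp
        exact absurd (ht'.1.trans h2) (not_le.2 this)
      · have hxq : q < x := by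
          by_contra hxq
          exact hx ⟨not_lt.1 hxp, not_lt.1 hxq⟩
        have hx0 : 0 ≤ x := by linarith
        change ∫ t in (0 : ℝ)..x, ξ t = 0
        rw [intervalIntegral.integral_of_le hx0, setIntegral_eq_integral_of_forall_compl_eq_zero,
          hξ0]
        intro t ht
        refine hsub t fun ht' => ht ⟨by linarith [ht'.1], by linarith [ht'.2]⟩
    have hΨt : tsupport Ψ ⊆ Icc p q :=
      closure_minimal (fun x hx => by_contra fun hx' => hx (hΨ0 x hx')) isClosed_Icc
    let ψ : TestFn L := ⟨Ψ, hΨ, isCompact_Icc.of_isClosed_subset (isClosed_tsupport _) hΨt,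
      hΨt.trans fun x hx => ⟨hp.trans_le hx.1, hx.2.trans_lt hq⟩⟩
    have h1 : ∫ x in Ioo 0 L, w x * ξ x = 0 := by
      have h2 := h ψ
      rw [show deriv (ψ : ℝ → ℝ) = ξ from hΨ'] at h2
      exact h2
    have hIset : ∫ x in Ioo 0 L, χ x = I :=
      setIntegral_eq_integral_of_forall_compl_eq_zero fun x hx =>
        image_eq_zero_of_notMem_tsupport fun hm => hx (hχt hm)
    have i1 := hmul χ hχ.continuous hχc
    have i2 := hmul η hηs.continuous hηc
    have h3 : ∫ x in Ioo 0 L, w x * ξ x = (∫ x in Ioo 0 L, w x * χ x) - I * c := by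
      rw [← integral_const_mul, ← integral_sub i1 (i2.const_mul I)]
      exact integral_congr_ae (ae_of_all _ fun x => by simp only [ξ]; ring)
    have h4 : ∫ x in Ioo 0 L, χ x * (w x - c) = (∫ x in Ioo 0 L, w x * χ x) - c * I := by
      rw [← hIset, ← integral_const_mul, ← integral_sub i1 (hχi.restrict.const_mul c)]
      exact integral_congr_ae (ae_of_all _ fun x => by ring)
    linarith [mul_comm I c]
  -- hence `w` is constant
  have hae : ∀ᵐ x ∂(volume : Measure ℝ), x ∈ Ioo 0 L → w x - c = 0 := by
    refine isOpen_Ioo.ae_eq_zero_of_integral_contDiff_smul_eq_zero (f := fun x => w x - c) ?_ ?_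
    · exact ((hwint.sub (integrableOn_const (by simp))).locallyIntegrableOn)
    · intro χ hχ hχc hχt
      rw [← hprim χ hχ hχc hχt]
      simp only [smul_eq_mul]
      refine (setIntegral_eq_integral_of_forall_compl_eq_zero fun x hx => ?_).symm
      rw [image_eq_zero_of_notMem_tsupport fun hm => hx (hχt hm), zero_mul]
  have hIoo : EqOn w (fun _ => c) (Ioo 0 L) := by
    refine Measure.eqOn_open_of_ae_eq (μ := volume) ?_ isOpen_Ioo
      (hw.mono Ioo_subset_Icc_self) continuousOn_const
    rw [EventuallyEq, ae_restrict_iff' measurableSet_Ioo]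
    filter_upwards [hae] with x hx hx' using sub_eq_zero.1 (hx hx')
  have hIcc : EqOn w (fun _ => c) (Icc 0 L) :=
    hIoo.of_subset_closure hw continuousOn_const Ioo_subset_Icc_self
      (by rw [closure_Ioo hL.ne])
  rw [hIoo hx₀, ← hIcc ⟨le_rfl, hL.le⟩, hw0]

theorem H10.deriv_injective (L : ℝ) : Function.Injective (H10.deriv (L := L)) := by
  rw [injective_iff_map_eq_zero]
  rintro ⟨⟨u, v⟩, h, w, hw, hw0, hwL, hu⟩ hv
  dsimp only at h hu
  have hv : v = 0 := hv
  have hv0 : (v : ℝ → ℝ) =ᵐ[volume.restrict (Ioo 0 L)] 0 := by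
    rw [hv]; exact Lp.coeFn_zero _ _ _
  have key := eq_zero_of_weakDeriv_zero hw hw0 (fun ψ => by
    have e1 : ∫ x in Ioo 0 L, w x * _root_.deriv ψ x = ∫ x in Ioo 0 L, u x * _root_.deriv ψ x :=
      integral_congr_ae (by filter_upwards [hu] with x hx; simp [hx])
    have e2 : ∫ x in Ioo 0 L, v x * ψ x = 0 :=
      integral_eq_zero_of_ae (by filter_upwards [hv0] with x hx; simp [hx])
    have h1 := h ψ
    rw [e1, h1, e2, neg_zero])
  have hu0 : u = 0 := by
    apply Lp.ext
    refine hu.trans (EventuallyEq.trans ?_ (Lp.coeFn_zero _ _ _).symm)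
    filter_upwards [ae_restrict_mem measurableSet_Ioo] with x hx using key x hx
  subst hv hu0
  rfl

/-- The norm of `H^1_0(0, L)` is the `L²` norm of the derivative. -/
noncomputable instance (L : ℝ) : NormedAddCommGroup (H10 L) :=
  NormedAddCommGroup.induced (H10 L) (L2 L) H10.deriv (H10.deriv_injective L)

noncomputable instance (L : ℝ) : NormedSpace ℝ (H10 L) :=
  NormedSpace.induced ℝ (H10 L) (L2 L) H10.deriv

/-- `a ∈ L^∞(0, L)` is bounded between two positive constants. -/
def IsElliptic {L : ℝ} (a : Linf L) : Prop :=
  ∃ α β : ℝ, 0 < α ∧ α < β ∧ ∀ᵐ x ∂(volume.restrict (Ioo 0 L)), α ≤ a x ∧ a x ≤ β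

/-- `φ` is a continuous function with values in `ℝ ∪ {+∞}`, which is finite outside `0`. -/
structure IsAdmissible (φ : ℝ → EReal) : Prop where
  ne_bot : ∀ s, φ s ≠ ⊥
  continuous : Continuous φ
  lt_top : ∀ s, s ≠ 0 → φ s < ⊤

/-- `φₙ` is a reasonable approximation of `φ`. -/
structure IsReasonableApprox (φ : ℝ → EReal) (φn : ℕ → ℝ → EReal) : Prop where
  admissible : ∀ n, IsAdmissible (φn n)
  tendsto : ∀ (s : ℕ → ℝ) (t : ℝ), Tendsto s atTop (𝓝 t) →
    Tendsto (fun n => φn n (s n)) atTop (𝓝 (φ t))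

/-- `-(a u')' = -f' - g'` in the sense of distributions on `(0, L)`, where `u'` is the
distributional derivative of `u`. -/
def SolvesInDistributions {L : ℝ} (a : Linf L) (g : L2 L) (f : ℝ → ℝ) (u : H10 L) : Prop :=
  ∀ ψ : TestFn L, ∫ x in Ioo 0 L, a x * u.deriv x * deriv ψ x
    = (∫ x in Ioo 0 L, f x * deriv ψ x) + ∫ x in Ioo 0 L, g x * deriv ψ x

/-- `u ∈ H^1_0(0, L)` is a weak solution for the data `(a, g, φ)`: the function `φ(u)` is finite
almost everywhere and belongs to `L²(0, L)`, and the equation holds in the sense of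
distributions. -/
def IsWeakSolution {L : ℝ} (a : Linf L) (g : L2 L) (φ : ℝ → EReal) (u : H10 L) : Prop :=
  (∀ᵐ x ∂(volume.restrict (Ioo 0 L)), φ (u.toL2 x) ≠ ⊤) ∧
  MemLp (fun x => (φ (u.toL2 x)).toReal) 2 (volume.restrict (Ioo 0 L)) ∧
  SolvesInDistributions a g (fun x => (φ (u.toL2 x)).toReal) u

/-- `u ∈ H^1_0(0, L)` is a classical weak solution for the data `(a, g, φ)`, where `φ` is a
continuous real function. -/
def IsClassicalWeakSolution {L : ℝ} (a : Linf L) (g : L2 L) (φ : ℝ → ℝ) (u : H10 L) : Prop :=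
  SolvesInDistributions a g (fun x => φ (u.toL2 x)) u

/-! In one dimension the equation integrates once: `u` solves the problem for a bounded `φ` iff `a
u' = φ(u) + g + c` for some constant `c`. Multiplying by `u'` kills both `φ(u) u'`, an exact
derivative, and `c u'`, because `u` vanishes at both ends. Hence `‖u‖ ≤ ‖g‖ / α`, whatever `φ` is
(`IsClassicalWeakSolution.norm_le`).

Suppose `|g| ≤ M`. For large `n`, `φn n` is huge near `0`. If `c` were not very negative, `u'` would
be positive wherever `u` is near `0`; `u` would leave `0` upwards and could never come back
(`H10.const_lt_of_large_near_zero`). So `c` is very negative. Away from `0` the functions `φn n` are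
eventually bounded above, so `u' ≤ 0` where `ε / 2 ≤ |u| ≤ ε`. Then `u` can neither climb to `ε`
from its value at the left end nor recover from below `-ε` before the right end
(`H10.abs_le_of_const_small`). All solutions are thus uniformly small, with a threshold on `n`
depending on `g` only through `M`. With the energy bound this gives weak convergence to `0`
(`H10.tendsto_toWeakSpace_zero`).

A general `g` is replaced by bounded functions tending to it, the indices being chosen after their
bounds. Existence uses the freedom to perturb the data: an Euler scheme with `c` tuned by shooting
solves the problem up to a small bounded error, which is absorbed into `g`
(`exists_isClassicalWeakSolution_near`). -/

/-! ### Primitives and the structure of `H^1_0` -/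

theorem L2.integrable {L : ℝ} (v : L2 L) : Integrable v (volume.restrict (Ioo 0 L)) :=
  (Lp.memLp v).integrable (by norm_num)

theorem L2.intervalIntegrable {L : ℝ} (hL : 0 < L) (v : L2 L) :
    IntervalIntegrable v volume 0 L :=
  (intervalIntegrable_iff_integrableOn_Ioo_of_le hL.le).2 (L2.integrable v)

theorem intervalIntegral_eq_setIntegral_Ioo {L : ℝ} (hL : 0 < L) (f : ℝ → ℝ) :
    ∫ x in (0 : ℝ)..L, f x = ∫ x in Ioo 0 L, f x := by
  rw [intervalIntegral.integral_of_le hL.le, integral_Ioc_eq_integral_Ioo]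

theorem TestFn.eq_zero_of_notMem {L : ℝ} (ψ : TestFn L) {x : ℝ} (hx : x ∉ Ioo 0 L) : ψ x = 0 :=
  image_eq_zero_of_notMem_tsupport fun h => hx (ψ.tsupport_subset h)

theorem TestFn.contDiff_one {L : ℝ} (ψ : TestFn L) : ContDiff ℝ 1 ψ :=
  ψ.contDiff.of_le (by exact_mod_cast le_top)

/-- The primitive of an integrable function has that function as its derivative almost
everywhere. -/
theorem ae_deriv_primitive_eq {L : ℝ} {v : ℝ → ℝ} (hv : IntervalIntegrable v volume 0 L) :
    ∀ᵐ x, x ∈ uIoc 0 L → HasDerivAt (fun x => ∫ t in (0 : ℝ)..x, v t) (v x) x := by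
  filter_upwards [hv.ae_hasDerivAt_integral] with x hx hx'
  exact hx (uIoc_subset_uIcc hx') 0 left_mem_uIcc

/-- Integration by parts for absolutely continuous functions; the boundary terms vanish with the
test function. -/
theorem isWeakDeriv_primitive {L : ℝ} (hL : 0 < L) {v : ℝ → ℝ}
    (hv : IntervalIntegrable v volume 0 L) :
    IsWeakDeriv L (fun x => ∫ t in (0 : ℝ)..x, v t) v := by
  intro ψ
  have h1 := (hv.absolutelyContinuousOnInterval_intervalIntegral
    left_mem_uIcc).integral_mul_deriv_eq_deriv_mul
    (ψ.contDiff_one.contDiffOn.absolutelyContinuousOnInterval)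
  rw [ψ.eq_zero_of_notMem (x := 0) (by simp), ψ.eq_zero_of_notMem (x := L) (by simp), mul_zero,
    mul_zero, sub_zero, zero_sub] at h1
  rw [← intervalIntegral_eq_setIntegral_Ioo hL, ← intervalIntegral_eq_setIntegral_Ioo hL, h1]
  congr 1
  refine intervalIntegral.integral_congr_ae ?_
  filter_upwards [ae_deriv_primitive_eq hv] with x hx hx'
  rw [(hx hx').deriv]

theorem continuousOn_primitive_Icc {L : ℝ} (hL : 0 < L) {v : ℝ → ℝ}
    (hv : IntervalIntegrable v volume 0 L) :
    ContinuousOn (fun x => ∫ t in (0 : ℝ)..x, v t) (Icc 0 L) := by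
  have := (hv.absolutelyContinuousOnInterval_intervalIntegral left_mem_uIcc).continuousOn
  rwa [uIcc_of_le hL.le] at this

theorem H10.isWeakDeriv {L : ℝ} (u : H10 L) : IsWeakDeriv L u.toL2 u.deriv := u.2.1

/-- An element of `H^1_0(0, L)` is the primitive of its derivative, whose integral is zero. -/
theorem H10.toL2_ae_eq_primitive {L : ℝ} (hL : 0 < L) (u : H10 L) :
    (u.toL2 =ᵐ[volume.restrict (Ioo 0 L)] fun x => ∫ t in (0 : ℝ)..x, u.deriv t) ∧
      ∫ t in (0 : ℝ)..L, u.deriv t = 0 := by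
  obtain ⟨w, hw, hw0, hwL, hu⟩ : VanishesAtEndpoints L u.toL2 := u.2.2
  have hv := L2.intervalIntegrable hL u.deriv
  have hW := continuousOn_primitive_Icc hL hv
  have hmul : ∀ {f : ℝ → ℝ}, ContinuousOn f (Icc 0 L) → ∀ ψ : TestFn L,
      Integrable (fun x => f x * _root_.deriv ψ x) (volume.restrict (Ioo 0 L)) := fun hf ψ =>
    ((hf.mul ψ.contDiff_deriv.continuous.continuousOn).integrableOn_Icc).mono_set
      Ioo_subset_Icc_self
  have hz : ∀ x ∈ Ioo 0 L, w x - (∫ t in (0 : ℝ)..x, u.deriv t) = 0 := by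
    refine eq_zero_of_weakDeriv_zero (hw.sub hW) (by simp [hw0]) fun ψ => ?_
    have e : ∫ x in Ioo 0 L, w x * _root_.deriv ψ x = ∫ x in Ioo 0 L, u.toL2 x * _root_.deriv ψ x :=
      integral_congr_ae (by filter_upwards [hu] with x hx; rw [hx])
    simp only [sub_mul]
    rw [integral_sub (hmul hw ψ) (hmul hW ψ), e, u.isWeakDeriv ψ, isWeakDeriv_primitive hL hv ψ,
      sub_self]
  have hIcc : EqOn (fun x => w x - ∫ t in (0 : ℝ)..x, u.deriv t) (fun _ => 0) (Icc 0 L) :=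
    EqOn.of_subset_closure (s := Ioo 0 L) hz (hw.sub hW) continuousOn_const Ioo_subset_Icc_self
      (by rw [closure_Ioo hL.ne])
  constructor
  · filter_upwards [hu, ae_restrict_mem measurableSet_Ioo] with x hx hx'
    rw [hx, sub_eq_zero.1 (hz x hx')]
  · have := hIcc ⟨hL.le, le_rfl⟩
    simp only [hwL, zero_sub, neg_eq_zero] at this
    exact this

/-- The primitive from `0` is the required function; zero mean of `v` is exactly its boundary
condition at `L`. -/
theorem H10.exists_deriv_eq {L : ℝ} (hL : 0 < L) (v : L2 L) (h : ∫ t in (0 : ℝ)..L, v t = 0) :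
    ∃ u : H10 L, u.deriv = v := by
  have hv := L2.intervalIntegrable hL v
  have hW := continuousOn_primitive_Icc hL hv
  obtain ⟨C, hC⟩ := isCompact_Icc.exists_bound_of_continuousOn hW
  have hmem : MemLp (fun x => ∫ t in (0 : ℝ)..x, v t) 2 (volume.restrict (Ioo 0 L)) := by
    refine MemLp.of_bound ((hW.mono Ioo_subset_Icc_self).aestronglyMeasurable measurableSet_Ioo) C ?_
    filter_upwards [ae_restrict_mem measurableSet_Ioo] with x hx using hC x (Ioo_subset_Icc_self hx)
  refine ⟨⟨(hmem.toLp _, v), fun ψ => ?_, _, hW, by simp, h, hmem.coeFn_toLp⟩, rfl⟩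
  rw [← isWeakDeriv_primitive hL hv ψ]
  exact integral_congr_ae (by filter_upwards [hmem.coeFn_toLp] with x hx; rw [hx])

theorem integral_deriv_testFn {L : ℝ} (hL : 0 < L) (ψ : TestFn L) :
    ∫ x in Ioo 0 L, deriv ψ x = 0 := by
  rw [← intervalIntegral_eq_setIntegral_Ioo hL,
    intervalIntegral.integral_deriv_eq_sub (fun x _ => ψ.contDiff_one.differentiable (by simp) x)
      (ψ.contDiff_deriv.continuous.intervalIntegrable _ _),
    ψ.eq_zero_of_notMem (x := 0) (by simp), ψ.eq_zero_of_notMem (x := L) (by simp), sub_self]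

/-! ### The first integral of the equation -/

/-- **Du Bois-Reymond's lemma**: a function with distributional derivative zero is constant. -/
theorem exists_ae_eq_const_of_weakDeriv_zero {L : ℝ} (hL : 0 < L) {w : ℝ → ℝ}
    (hwint : IntegrableOn w (Ioo 0 L))
    (h : ∀ ψ : TestFn L, ∫ x in Ioo 0 L, w x * deriv ψ x = 0) :
    ∃ c : ℝ, ∀ᵐ x ∂(volume.restrict (Ioo 0 L)), w x = c := by
  let b : ContDiffBump (L / 2) := ⟨L / 8, L / 4, by positivity, by linarith⟩
  let η : ℝ → ℝ := b.normed volume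
  have hηs : ContDiff ℝ ((⊤ : ℕ∞) : WithTop ℕ∞) η := b.contDiff_normed
  have hηt : tsupport η ⊆ Ioo 0 L := by
    rw [show tsupport η = _ from b.tsupport_normed_eq, Real.closedBall_eq_Icc]
    intro x hx
    simp only [b, mem_Icc] at hx
    constructor <;> linarith [hx.1, hx.2]
  have hηc : HasCompactSupport η := b.hasCompactSupport_normed
  have hη1 : ∫ x, η x = 1 := b.integral_normed
  -- Testing against `η`, which has integral one, identifies the only possible constant.
  let c : ℝ := ∫ x in Ioo 0 L, w x * η x
  have hmul : ∀ f : ℝ → ℝ, Continuous f → HasCompactSupport f →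
      Integrable (fun x => w x * f x) (volume.restrict (Ioo 0 L)) := by
    intro f hf hfc
    obtain ⟨C, hC⟩ := hf.bounded_above_of_compact_support hfc
    exact hwint.mul_bdd hf.aestronglyMeasurable (ae_of_all _ hC)
  have hset : ∀ f : ℝ → ℝ, tsupport f ⊆ Ioo 0 L → ∫ x in Ioo 0 L, f x = ∫ x, f x := fun f hf =>
    setIntegral_eq_integral_of_forall_compl_eq_zero fun x hx =>
      image_eq_zero_of_notMem_tsupport fun hm => hx (hf hm)
  have hprim : ∀ χ : ℝ → ℝ, ContDiff ℝ ((⊤ : ℕ∞) : WithTop ℕ∞) χ → HasCompactSupport χ →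
      tsupport χ ⊆ Ioo 0 L → ∫ x in Ioo 0 L, χ x * (w x - c) = 0 := by
    intro χ hχ hχc hχt
    let I : ℝ := ∫ x, χ x
    -- Subtracting `I * η` makes the integral zero, so that the primitive of `ξ` has compact support
    -- and is an admissible test function.
    let ξ : ℝ → ℝ := fun x => χ x - I * η x
    have hξ : ContDiff ℝ ((⊤ : ℕ∞) : WithTop ℕ∞) ξ := hχ.sub (contDiff_const.mul hηs)
    have hχi : Integrable χ := hχ.continuous.integrable_of_hasCompactSupport hχc
    have hηi : Integrable η := hηs.continuous.integrable_of_hasCompactSupport hηc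
    have hξ0 : ∫ x in (0 : ℝ)..L, ξ x = 0 := by
      rw [intervalIntegral_eq_setIntegral_Ioo hL]
      simp only [ξ]
      rw [integral_sub hχi.restrict (hηi.restrict.const_mul I), integral_const_mul, hset η hηt,
        hset χ hχt, hη1]
      simp [I]
    let K : Set ℝ := tsupport χ ∪ tsupport η
    have hK : IsCompact K := hχc.isCompact.union hηc.isCompact
    have hKs : K ⊆ Ioo 0 L := union_subset hχt hηt
    have hsub : ∀ x ∉ K, ξ x = 0 := fun x hx => by
      have h1 : χ x = 0 := image_eq_zero_of_notMem_tsupport fun hm => hx (Or.inl hm)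
      have h2 : η x = 0 := image_eq_zero_of_notMem_tsupport fun hm => hx (Or.inr hm)
      simp [ξ, h1, h2]
    obtain ⟨p, q, hp, hq, hpq⟩ : ∃ p q : ℝ, 0 < p ∧ q < L ∧ K ⊆ Icc p q := by
      rcases K.eq_empty_or_nonempty with he | hne
      · exact ⟨1, L - 1, one_pos, by linarith, by simp [he]⟩
      · exact ⟨sInf K, sSup K, (hKs (hK.sInf_mem hne)).1, (hKs (hK.sSup_mem hne)).2,
          fun x hx => ⟨csInf_le hK.bddBelow hx, le_csSup hK.bddAbove hx⟩⟩
    let Ψ : ℝ → ℝ := fun x => ∫ t in (0 : ℝ)..x, ξ t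
    have hii : ∀ x y, IntervalIntegrable ξ volume x y := fun x y =>
      hξ.continuous.intervalIntegrable _ _
    have hΨd : ∀ x, HasDerivAt Ψ (ξ x) x := fun x =>
      intervalIntegral.integral_hasDerivAt_right (hii _ _)
        (hξ.continuous.stronglyMeasurableAtFilter _ _) hξ.continuous.continuousAt
    have hΨ' : deriv Ψ = ξ := funext fun x => (hΨd x).deriv
    have hΨ : ContDiff ℝ ((⊤ : ℕ∞) : WithTop ℕ∞) Ψ :=
      contDiff_infty_iff_deriv.2 ⟨fun x => (hΨd x).differentiableAt, hΨ' ▸ hξ⟩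
    have hΨ0 : ∀ x, x ∉ Icc p q → Ψ x = 0 := by
      intro x hx
      have hz : ∀ y z, uIcc y z ∩ Icc p q = ∅ → ∫ t in y..z, ξ t = 0 := fun y z hyz => by
        refine intervalIntegral.integral_zero_ae (ae_of_all _ fun t ht => hsub t fun hm => ?_)
        have : t ∈ uIcc y z ∩ Icc p q := ⟨uIoc_subset_uIcc ht, hpq hm⟩
        rw [hyz] at this
        exact this
      rcases not_and_or.1 hx with hxp | hxq
      · refine hz _ _ (eq_empty_of_forall_notMem fun t ht => ?_)
        have := ht.1.2
        rcases le_sup_iff.1 this with h1 | h1 <;> linarith [ht.2.1]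
      -- To the right of the support, the primitive equals the total integral of `ξ`, which is zero.
      · have h1 : ∫ t in x..L, ξ t = 0 := by
          refine hz _ _ (eq_empty_of_forall_notMem fun t ht => ?_)
          have := ht.1.1
          rcases inf_le_iff.1 this with h1 | h1 <;> linarith [ht.2.2]
        have := intervalIntegral.integral_add_adjacent_intervals (hii 0 x) (hii x L)
        rw [hξ0, h1, add_zero] at this
        exact this
    have hΨt : tsupport Ψ ⊆ Icc p q :=
      closure_minimal (fun x hx => by_contra fun hx' => hx (hΨ0 x hx')) isClosed_Icc
    let ψ : TestFn L := ⟨Ψ, hΨ, isCompact_Icc.of_isClosed_subset (isClosed_tsupport _) hΨt,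
      hΨt.trans fun x hx => ⟨hp.trans_le hx.1, hx.2.trans_lt hq⟩⟩
    have h1 : ∫ x in Ioo 0 L, w x * ξ x = 0 := by
      have h2 := h ψ
      rw [show deriv (ψ : ℝ → ℝ) = ξ from hΨ'] at h2
      exact h2
    have hIset : ∫ x in Ioo 0 L, χ x = I := hset χ hχt
    have i1 := hmul χ hχ.continuous hχc
    have i2 := hmul η hηs.continuous hηc
    have h3 : ∫ x in Ioo 0 L, w x * ξ x = (∫ x in Ioo 0 L, w x * χ x) - I * c := by
      rw [← integral_const_mul, ← integral_sub i1 (i2.const_mul I)]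
      exact integral_congr_ae (ae_of_all _ fun x => by simp only [ξ]; ring)
    have h4 : ∫ x in Ioo 0 L, χ x * (w x - c) = (∫ x in Ioo 0 L, w x * χ x) - c * I := by
      rw [← hIset, ← integral_const_mul, ← integral_sub i1 (hχi.restrict.const_mul c)]
      exact integral_congr_ae (ae_of_all _ fun x => by ring)
    linarith [mul_comm I c]
  refine ⟨c, (ae_restrict_iff' measurableSet_Ioo).2 ?_⟩
  have hae : ∀ᵐ x ∂(volume : Measure ℝ), x ∈ Ioo 0 L → w x - c = 0 := by
    refine isOpen_Ioo.ae_eq_zero_of_integral_contDiff_smul_eq_zero (f := fun x => w x - c) ?_ ?_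
    · exact ((hwint.sub (integrableOn_const (by simp))).locallyIntegrableOn)
    · intro χ hχ hχc hχt
      rw [← hprim χ hχ hχc hχt]
      simp only [smul_eq_mul]
      refine (setIntegral_eq_integral_of_forall_compl_eq_zero fun x hx => ?_).symm
      rw [image_eq_zero_of_notMem_tsupport fun hm => hx (hχt hm), zero_mul]
  filter_upwards [hae] with x hx hx' using sub_eq_zero.1 (hx hx')

theorem Linf.memLp_two_mul {L : ℝ} {a : Linf L} (v : L2 L) :
    MemLp (fun x => a x * v x) 2 (volume.restrict (Ioo 0 L)) :=
  (Lp.memLp v).mul (Lp.memLp a)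

/-- First integral of the equation. -/
theorem solvesInDistributions_iff {L : ℝ} (hL : 0 < L) {a : Linf L} {g : L2 L} {f : ℝ → ℝ}
    {u : H10 L} (hf : MemLp f 2 (volume.restrict (Ioo 0 L))) :
    SolvesInDistributions a g f u ↔
      ∃ c : ℝ, ∀ᵐ x ∂(volume.restrict (Ioo 0 L)), a x * u.deriv x = f x + g x + c := by
  have ha : MemLp (fun x => a x * u.deriv x) 2 (volume.restrict (Ioo 0 L)) :=
    Linf.memLp_two_mul u.deriv
  have i1 := fun ψ : TestFn L => ha.integrable_mul ψ.memLp_two_deriv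
  have i2 := fun ψ : TestFn L => hf.integrable_mul ψ.memLp_two_deriv
  have i3 := fun ψ : TestFn L => integrable_mul_of_L2 g ψ.memLp_two_deriv
  constructor
  · intro h
    obtain ⟨c, hc⟩ := exists_ae_eq_const_of_weakDeriv_zero hL
      (w := fun x => a x * u.deriv x - f x - g x)
      (((ha.sub hf).sub (Lp.memLp g)).integrable (by norm_num)) fun ψ => by
        simp only [sub_mul]
        have h1 := integral_sub ((i1 ψ).sub (i2 ψ)) (i3 ψ)
        have h2 := integral_sub (i1 ψ) (i2 ψ)
        simp only [Pi.mul_apply, Pi.sub_apply] at h1 h2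
        rw [h1, h2, h ψ]
        ring
    exact ⟨c, by filter_upwards [hc] with x hx; linarith⟩
  · rintro ⟨c, hc⟩ ψ
    have i4 : Integrable (fun x => c * deriv ψ x) (volume.restrict (Ioo 0 L)) :=
      (ψ.memLp_two_deriv.integrable (by norm_num)).const_mul c
    have e : ∫ x in Ioo 0 L, a x * u.deriv x * deriv ψ x
        = ∫ x in Ioo 0 L, (f x * deriv ψ x + g x * deriv ψ x + c * deriv ψ x) :=
      integral_congr_ae (by filter_upwards [hc] with x hx; rw [hx]; ring)
    have h1 := integral_add ((i2 ψ).add (i3 ψ)) i4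
    have h2 := integral_add (i2 ψ) (i3 ψ)
    simp only [Pi.mul_apply, Pi.add_apply] at h1 h2
    rw [e, h1, h2, integral_const_mul, integral_deriv_testFn hL, mul_zero, add_zero]

/-! ### The energy identity and the a priori bound -/

/-- Needed to apply the fundamental theorem of calculus to `Φ(u)`, with `Φ` an antiderivative of a
bounded `φ`. -/
theorem LipschitzWith.comp_absolutelyContinuousOnInterval {K : NNReal} {Φ w : ℝ → ℝ} {p q : ℝ}
    (hΦ : LipschitzWith K Φ) (hw : AbsolutelyContinuousOnInterval w p q) :
    AbsolutelyContinuousOnInterval (fun x => Φ (w x)) p q := by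
  have h0 : Tendsto (fun E : ℕ × (ℕ → ℝ × ℝ) =>
      (K : ℝ) * ∑ i ∈ Finset.range E.1, dist (w (E.2 i).1) (w (E.2 i).2))
      (AbsolutelyContinuousOnInterval.totalLengthFilter ⊓
        𝓟 (AbsolutelyContinuousOnInterval.disjWithin p q)) (𝓝 0) := by
    simpa only [mul_zero] using Tendsto.const_mul (K : ℝ) (show Tendsto _ _ (𝓝 0) from hw)
  refine squeeze_zero (fun E => Finset.sum_nonneg fun i _ => dist_nonneg) (fun E => ?_) h0
  rw [Finset.mul_sum]
  exact Finset.sum_le_sum fun i _ => hΦ.dist_le_mul _ _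

/-- The energy identity: `φ(u) u'` is the derivative of a function of `u`. -/
theorem H10.integral_comp_mul_deriv {L : ℝ} (hL : 0 < L) (φ : ℝ →ᵇ ℝ) (u : H10 L) :
    ∫ x in Ioo 0 L, φ (u.toL2 x) * u.deriv x = 0 := by
  obtain ⟨hu, huL⟩ := u.toL2_ae_eq_primitive hL
  have hv := L2.intervalIntegrable hL u.deriv
  let Φ : ℝ → ℝ := fun s => ∫ t in (0 : ℝ)..s, φ t
  have hΦ : ∀ s, HasDerivAt Φ (φ s) s := fun s =>
    intervalIntegral.integral_hasDerivAt_right (φ.continuous.intervalIntegrable _ _)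
      (φ.continuous.stronglyMeasurableAtFilter _ _) φ.continuous.continuousAt
  have hLip : LipschitzWith ‖φ‖₊ Φ :=
    lipschitzWith_of_nnnorm_deriv_le (fun s => (hΦ s).differentiableAt) fun s => by
      rw [(hΦ s).deriv]; exact φ.nnnorm_coe_le_nnnorm s
  have hAC := hLip.comp_absolutelyContinuousOnInterval
    (hv.absolutelyContinuousOnInterval_intervalIntegral left_mem_uIcc)
  have h1 := hAC.integral_deriv_eq_sub
  -- Both boundary values of `Φ(u)` are `Φ 0`, so the integral of its derivative vanishes.
  rw [huL, intervalIntegral.integral_same, sub_self] at h1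
  rw [intervalIntegral_eq_setIntegral_Ioo hL] at h1
  refine Eq.trans (integral_congr_ae ?_) h1
  filter_upwards [hu, ae_restrict_of_ae (ae_deriv_primitive_eq hv), ae_restrict_mem measurableSet_Ioo]
    with x hx hx' hmem
  have := hx' (by rw [uIoc_of_le hL.le]; exact Ioo_subset_Ioc_self hmem)
  rw [hx]
  exact ((hΦ _).comp x this).deriv.symm

theorem BoundedContinuousFunction.memLp_comp {L : ℝ} (φ : ℝ →ᵇ ℝ) (u : L2 L) :
    MemLp (fun x => φ (u x)) 2 (volume.restrict (Ioo 0 L)) :=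
  MemLp.of_bound (φ.continuous.comp_aestronglyMeasurable (Lp.aestronglyMeasurable u)) ‖φ‖
    (ae_of_all _ fun _ => φ.norm_coe_le_norm _)

theorem isClassicalWeakSolution_iff {L : ℝ} (hL : 0 < L) {a : Linf L} {g : L2 L} {φ : ℝ →ᵇ ℝ}
    {u : H10 L} : IsClassicalWeakSolution a g φ u ↔
      ∃ c : ℝ, ∀ᵐ x ∂(volume.restrict (Ioo 0 L)),
        a x * u.deriv x = φ (u.toL2 x) + g x + c :=
  solvesInDistributions_iff hL (φ.memLp_comp u.toL2)

theorem H10.norm_eq {L : ℝ} (u : H10 L) : ‖u‖ = ‖u.deriv‖ := rfl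

/-- The a priori estimate for classical weak solutions. -/
theorem IsClassicalWeakSolution.norm_le {L : ℝ} (hL : 0 < L) {a : Linf L} {g : L2 L} {φ : ℝ →ᵇ ℝ}
    {u : H10 L} (hu : IsClassicalWeakSolution a g φ u) {α : ℝ} (hα : 0 < α)
    (ha : ∀ᵐ x ∂(volume.restrict (Ioo 0 L)), α ≤ a x) : ‖u‖ ≤ ‖g‖ / α := by
  obtain ⟨c, hc⟩ := (isClassicalWeakSolution_iff hL).1 hu
  have hv := Lp.memLp u.deriv
  have hint : ∫ x in Ioo 0 L, u.deriv x = 0 := by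
    rw [← intervalIntegral_eq_setIntegral_Ioo hL]
    exact (u.toL2_ae_eq_primitive hL).2
  have i1 : Integrable (fun x => φ (u.toL2 x) * u.deriv x) (volume.restrict (Ioo 0 L)) :=
    (φ.memLp_comp u.toL2).integrable_mul hv
  have i2 : Integrable (fun x => g x * u.deriv x) (volume.restrict (Ioo 0 L)) :=
    integrable_mul_of_L2 g hv
  have i3 : Integrable (fun x => c * u.deriv x) (volume.restrict (Ioo 0 L)) :=
    (L2.integrable u.deriv).const_mul c
  have i4 : Integrable (fun x => u.deriv x * u.deriv x) (volume.restrict (Ioo 0 L)) :=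
    integrable_mul_of_L2 u.deriv hv
  have h1 : ∫ x in Ioo 0 L, (φ (u.toL2 x) * u.deriv x + g x * u.deriv x + c * u.deriv x)
      = ∫ x in Ioo 0 L, g x * u.deriv x := by
    have e1 := integral_add (i1.add i2) i3
    simp only [Pi.add_apply] at e1
    rw [e1, integral_add i1 i2, u.integral_comp_mul_deriv hL, integral_const_mul, hint]
    ring
  have h2 : α * ∫ x in Ioo 0 L, u.deriv x * u.deriv x ≤ ∫ x in Ioo 0 L, g x * u.deriv x := by
    rw [← h1, ← integral_const_mul]
    refine integral_mono_ae (i4.const_mul α) ((i1.add i2).add i3) ?_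
    filter_upwards [hc, ha] with x hx hx'
    have e : φ (u.toL2 x) * u.deriv x + g x * u.deriv x + c * u.deriv x
        = a x * (u.deriv x * u.deriv x) := by rw [← mul_assoc, hx]; ring
    change α * (u.deriv x * u.deriv x) ≤ _
    rw [e]
    exact mul_le_mul_of_nonneg_right hx' (mul_self_nonneg _)
  have h3 : ∀ p q : L2 L, ∫ x in Ioo 0 L, p x * q x = inner ℝ q p := fun p q => by
    rw [L2.inner_def]
    exact integral_congr_ae (ae_of_all _ fun x => by simp)
  rw [h3, h3, real_inner_self_eq_norm_sq] at h2
  have h4 := h2.trans (real_inner_le_norm _ _)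
  rw [u.norm_eq, le_div_iff₀ hα]
  rcases (norm_nonneg u.deriv).eq_or_lt with h0 | h0
  · rw [← h0, zero_mul]; exact norm_nonneg _
  · nlinarith

/-! ### Crossing arguments and bounds on the solution -/

/-- Take `y` to be the first point where `w` is at least `h₂`, then `x` the last point of `[p, y]`
where `w` is at most `h₁`. -/
theorem exists_crossing {w : ℝ → ℝ} {p q h₁ h₂ : ℝ} (hw : ContinuousOn w (Icc p q)) (hpq : p ≤ q)
    (hp : w p ≤ h₁) (hq : h₂ ≤ w q) :
    ∃ x y, p ≤ x ∧ x ≤ y ∧ y ≤ q ∧ w x ≤ h₁ ∧ h₂ ≤ w y ∧ ∀ t ∈ Ioo x y, h₁ < w t ∧ w t < h₂ := by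
  have hS : IsCompact (Icc p q ∩ w ⁻¹' Ici h₂) :=
    isCompact_Icc.of_isClosed_subset (hw.preimage_isClosed_of_isClosed isClosed_Icc isClosed_Ici)
      inter_subset_left
  obtain ⟨y, ⟨hy, hy'⟩, hmin⟩ := hS.exists_isLeast ⟨q, ⟨hpq, le_rfl⟩, hq⟩
  have hwy : ContinuousOn w (Icc p y) := hw.mono (Icc_subset_Icc_right hy.2)
  have hT : IsCompact (Icc p y ∩ w ⁻¹' Iic h₁) :=
    isCompact_Icc.of_isClosed_subset (hwy.preimage_isClosed_of_isClosed isClosed_Icc isClosed_Iic)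
      inter_subset_left
  obtain ⟨x, ⟨hx, hx'⟩, hmax⟩ := hT.exists_isGreatest ⟨p, ⟨le_rfl, hy.1⟩, hp⟩
  refine ⟨x, y, hx.1, hx.2, hy.2, hx', hy', fun t ht => ⟨?_, ?_⟩⟩
  · by_contra hn
    exact absurd (hmax ⟨⟨hx.1.trans ht.1.le, ht.2.le⟩, not_lt.1 hn⟩) (not_le.2 ht.1)
  · by_contra hn
    exact absurd (hmin ⟨⟨hx.1.trans ht.1.le, ht.2.le.trans hy.2⟩, not_lt.1 hn⟩) (not_le.2 ht.2)

/-- A primitive whose derivative is nonpositive between two heights does not rise from the lower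
to the higher. -/
theorem not_rise_of_nonpos {L : ℝ} {v : ℝ → ℝ} (hv : IntervalIntegrable v volume 0 L)
    {p q h₁ h₂ : ℝ} (hp : 0 ≤ p) (hpq : p ≤ q) (hq : q ≤ L) (h12 : h₁ < h₂)
    (hwp : ∫ t in (0 : ℝ)..p, v t ≤ h₁)
    (h : ∀ᵐ x ∂(volume.restrict (Ioo 0 L)), h₁ < ∫ t in (0 : ℝ)..x, v t →
      ∫ t in (0 : ℝ)..x, v t < h₂ → v x ≤ 0) :
    ∫ t in (0 : ℝ)..q, v t < h₂ := by
  by_contra! hwq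
  have hw : ContinuousOn (fun x => ∫ t in (0 : ℝ)..x, v t) (Icc p q) := by
    refine (hv.absolutelyContinuousOnInterval_intervalIntegral left_mem_uIcc).continuousOn.mono ?_
    rw [uIcc_of_le (hp.trans (hpq.trans hq))]
    exact Icc_subset_Icc hp hq
  obtain ⟨x, y, hx, hxy, hy, hwx, hwy, hxyt⟩ := exists_crossing hw hpq hwp hwq
  have hsub : ∀ z ∈ Icc 0 L, IntervalIntegrable v volume 0 z := fun z hz => hv.mono_set (by
    rw [uIcc_of_le hz.1, uIcc_of_le (hz.1.trans hz.2)]; exact Icc_subset_Icc_right hz.2)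
  have hle : ∫ t in x..y, v t ≤ 0 := by
    rw [intervalIntegral.integral_of_le hxy, integral_Ioc_eq_integral_Ioo]
    refine integral_nonpos_of_ae ?_
    filter_upwards [ae_restrict_of_ae_restrict_of_subset
      (Ioo_subset_Ioo (hp.trans hx) (hy.trans hq)) h, ae_restrict_mem measurableSet_Ioo] with t ht htm
    exact ht (hxyt t htm).1 (hxyt t htm).2
  have e := intervalIntegral.integral_interval_sub_left
    (hsub y ⟨by linarith, by linarith⟩) (hsub x ⟨by linarith, by linarith⟩)
  linarith

/-- By continuity the primitive stays within `δ` of its initial value `0` on a short interval, where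
its derivative is therefore at least `κ`. -/
theorem exists_pos_primitive_of_pos {L : ℝ} (hL : 0 < L) {v : ℝ → ℝ}
    (hv : IntervalIntegrable v volume 0 L) {δ κ : ℝ} (hδ : 0 < δ) (hκ : 0 < κ)
    (h : ∀ᵐ x ∂(volume.restrict (Ioo 0 L)), |∫ t in (0 : ℝ)..x, v t| ≤ δ → κ ≤ v x) :
    ∃ x ∈ Icc 0 L, 0 < ∫ t in (0 : ℝ)..x, v t := by
  have hw := continuousOn_primitive_Icc hL hv
  obtain ⟨η, hη, hηδ⟩ := Metric.continuousOn_iff.1 hw 0 ⟨le_rfl, hL.le⟩ δ hδ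
  have hm : 0 < min (η / 2) L := lt_min (by positivity) hL
  have hmL : min (η / 2) L ≤ L := min_le_right _ _
  refine ⟨min (η / 2) L, ⟨hm.le, hmL⟩, ?_⟩
  have hi : IntervalIntegrable v volume 0 (min (η / 2) L) := hv.mono_set (by
    rw [uIcc_of_le hm.le, uIcc_of_le hL.le]; exact Icc_subset_Icc_right hmL)
  have hle : ∫ _ in (0 : ℝ)..(min (η / 2) L), κ ≤ ∫ t in (0 : ℝ)..(min (η / 2) L), v t := by
    rw [intervalIntegral.integral_of_le hm.le, intervalIntegral.integral_of_le hm.le,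
      integral_Ioc_eq_integral_Ioo, integral_Ioc_eq_integral_Ioo]
    refine integral_mono_ae (integrable_const _)
      ((intervalIntegrable_iff_integrableOn_Ioo_of_le hm.le).1 hi) ?_
    filter_upwards [ae_restrict_of_ae_restrict_of_subset (Ioo_subset_Ioo_right hmL) h,
      ae_restrict_mem measurableSet_Ioo] with t ht htm
    refine ht ?_
    have := hηδ t ⟨htm.1.le, htm.2.le.trans hmL⟩ (by
      rw [Real.dist_eq, sub_zero, abs_of_pos htm.1]
      linarith [htm.2, min_le_left (η / 2) L])
    simp only [intervalIntegral.integral_same, Real.dist_eq, sub_zero] at this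
    exact this.le
  rw [intervalIntegral.integral_const, smul_eq_mul, sub_zero] at hle
  exact (mul_pos hm hκ).trans_le hle

section Estimates

variable {L : ℝ} {a : Linf L} {g : L2 L} {φ : ℝ →ᵇ ℝ} {u : H10 L} {α β M c : ℝ}

/-- If `φ` is large near `0`, the constant in the first integral is very negative: otherwise `u`
would be increasing near each of its zeros. -/
theorem H10.const_lt_of_large_near_zero (hL : 0 < L) (hα : 0 < α)
    (ha : ∀ᵐ x ∂(volume.restrict (Ioo 0 L)), α ≤ a x ∧ a x ≤ β)
    (hg : ∀ᵐ x ∂(volume.restrict (Ioo 0 L)), |g x| ≤ M)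
    (hc : ∀ᵐ x ∂(volume.restrict (Ioo 0 L)), a x * u.deriv x = φ (u.toL2 x) + g x + c)
    {C δ : ℝ} (hδ : 0 < δ) (hφ : ∀ s, |s| ≤ δ → C + M + 1 ≤ φ s) : c < -C := by
  by_contra! hcC
  obtain ⟨hu, huL⟩ := u.toL2_ae_eq_primitive hL
  have hv := L2.intervalIntegrable hL u.deriv
  -- The interval has positive measure, so the almost everywhere bounds hold at some point; this
  -- gives `β > 0`.
  have hne : (volume.restrict (Ioo 0 L)) ≠ 0 := by simp [Measure.restrict_eq_zero, hL]
  have : NeBot (ae (volume.restrict (Ioo 0 L))) := ae_neBot.2 hne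
  obtain ⟨x₁, hx₁⟩ := ha.exists
  have hβ : 0 < β := hα.trans_le (hx₁.1.trans hx₁.2)
  have key : ∀ᵐ x ∂(volume.restrict (Ioo 0 L)), |∫ t in (0 : ℝ)..x, u.deriv t| ≤ δ →
      1 / β ≤ u.deriv x := by
    filter_upwards [ha, hg, hc, hu] with x hax hgx hcx hux hδx
    rw [← hux] at hδx
    have h1 := hφ _ hδx
    have h2 : 1 ≤ a x * u.deriv x := by rw [hcx]; linarith [(abs_le.1 hgx).1]
    have h3 : 0 < u.deriv x := by
      by_contra! hn
      linarith [mul_nonpos_of_nonneg_of_nonpos (hα.le.trans hax.1) hn]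
    rw [div_le_iff₀ hβ]
    nlinarith [hax.2]
  obtain ⟨x, hx, hpos⟩ := exists_pos_primitive_of_pos hL hv hδ (by positivity) key
  -- Applied to `-u`, which would have to rise from a negative value at `x` to `0` at `L` through
  -- heights where `u` is increasing.
  have := not_rise_of_nonpos (v := fun t => -u.deriv t) hv.neg (p := x) (q := L)
    (h₁ := -min δ (∫ t in (0 : ℝ)..x, u.deriv t)) (h₂ := 0) hx.1 hx.2 le_rfl
    (by simpa using ⟨hδ, hpos⟩)
    (by rw [intervalIntegral.integral_neg]; exact neg_le_neg (min_le_right _ _)) (by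
      filter_upwards [key] with y hy h1 h2
      rw [intervalIntegral.integral_neg] at h1 h2
      have h3 : |∫ t in (0 : ℝ)..y, u.deriv t| ≤ δ := by
        rw [abs_of_pos (by linarith)]
        linarith [min_le_left δ (∫ t in (0 : ℝ)..x, u.deriv t)]
      linarith [hy h3, (by positivity : 0 < 1 / β)])
  rw [intervalIntegral.integral_neg, huL, neg_zero] at this
  exact lt_irrefl _ this

/-- If the constant in the first integral is very negative, then `u` decreases where `|u|` is
between `ε / 2` and `ε`, and `|u|` stays below `ε`. -/
theorem H10.abs_le_of_const_small (hL : 0 < L) (hα : 0 < α)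
    (ha : ∀ᵐ x ∂(volume.restrict (Ioo 0 L)), α ≤ a x)
    (hg : ∀ᵐ x ∂(volume.restrict (Ioo 0 L)), |g x| ≤ M)
    (hc : ∀ᵐ x ∂(volume.restrict (Ioo 0 L)), a x * u.deriv x = φ (u.toL2 x) + g x + c)
    {B ε : ℝ} (hε : 0 < ε) (hφ : ∀ s, |s| ∈ Icc (ε / 2) ε → φ s ≤ B) (hcB : c ≤ -(B + M)) :
    ∀ᵐ x ∂(volume.restrict (Ioo 0 L)), |u.toL2 x| ≤ ε := by
  obtain ⟨hu, huL⟩ := u.toL2_ae_eq_primitive hL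
  have hv := L2.intervalIntegrable hL u.deriv
  have key : ∀ᵐ x ∂(volume.restrict (Ioo 0 L)),
      |∫ t in (0 : ℝ)..x, u.deriv t| ∈ Icc (ε / 2) ε → u.deriv x ≤ 0 := by
    filter_upwards [ha, hg, hc, hu] with x hax hgx hcx hux hδx
    rw [← hux] at hδx
    by_contra! hn
    have h1 := hφ _ hδx
    linarith [mul_pos (hα.trans_le hax) hn, (abs_le.1 hgx).2]
  filter_upwards [hu, ae_restrict_mem measurableSet_Ioo] with x hx hxm
  rw [hx, abs_le]
  constructor
  · by_contra! hn
    -- Once below `-ε`, `u` would have to rise past `-(ε / 2)` to vanish at `L`. The upper bound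
    -- instead starts from `u = 0` at the left end.
    have := not_rise_of_nonpos hv (h₁ := -ε) (h₂ := -(ε / 2)) hxm.1.le hxm.2.le le_rfl
      (by linarith) hn.le (by
        filter_upwards [key] with y hy h1 h2
        refine hy ?_
        rw [abs_of_neg (by linarith)]
        constructor <;> linarith)
    rw [huL] at this
    linarith
  · refine (not_rise_of_nonpos hv (h₁ := ε / 2) (h₂ := ε) le_rfl hxm.1.le hxm.2.le
      (by linarith) (by simpa using (half_pos hε).le) ?_).le
    filter_upwards [key] with y hy h1 h2
    refine hy ?_
    rw [abs_of_pos (by linarith)]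
    exact ⟨h1.le, h2.le⟩

end Estimates

/-! ### Uniform consequences of reasonable approximation -/

/-- This turns the sequential hypothesis into convergence that is uniform near a point:
neighbourhoods of `t` and thresholds on `n` can then be chosen independently. -/
theorem tendsto_prod_of_forall_seq {X Y : Type*} [TopologicalSpace X] [FirstCountableTopology X]
    [TopologicalSpace Y] {F : ℕ → X → Y} {t : X} {y : Y}
    (h : ∀ s : ℕ → X, Tendsto s atTop (𝓝 t) → Tendsto (fun n => F n (s n)) atTop (𝓝 y)) :
    Tendsto (fun p : ℕ × X => F p.1 p.2) (atTop ×ˢ 𝓝 t) (𝓝 y) := by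
  refine tendsto_of_subseq_tendsto fun p hp => ?_
  obtain ⟨hp1, hp2⟩ := tendsto_prod_iff'.1 hp
  obtain ⟨m, hm, hm'⟩ := strictMono_subseq_of_tendsto_atTop hp1
  refine ⟨m, ?_⟩
  set ν : ℕ → ℕ := (fun n => (p n).1) ∘ m with hν
  -- The hypothesis concerns full sequences, so the given values are placed at the indices `ν k` and
  -- the gaps are filled with the limit `t`.
  set σ : ℕ → X := Function.extend ν (fun k => (p (m k)).2) fun _ => t with hσ
  have hσν : ∀ k, σ (ν k) = (p (m k)).2 := fun k => hm'.injective.extend_apply _ _ _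
  have hσt : Tendsto σ atTop (𝓝 t) := by
    intro S hS
    obtain ⟨K, hK⟩ := eventually_atTop.1 ((hp2.comp hm.tendsto_atTop).eventually hS)
    refine mem_map.2 (mem_atTop_sets.2 ⟨ν K, fun i hi => ?_⟩)
    by_cases hi' : ∃ k, ν k = i
    · obtain ⟨k, rfl⟩ := hi'
      change σ (ν k) ∈ S
      rw [hσν]
      exact hK k (hm'.le_iff_le.1 hi)
    · change σ i ∈ S
      rw [hσ, Function.extend_apply' _ _ _ hi']
      exact mem_of_mem_nhds hS
  have := (h σ hσt).comp hm'.tendsto_atTop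
  refine this.congr fun k => ?_
  simp only [Function.comp_apply, hσν]
  rfl

section Approximation

variable {φ : ℝ → EReal} {φn : ℕ → ℝ →ᵇ ℝ}

theorem IsReasonableApprox.exists_lower_bound
    (h : IsReasonableApprox φ (fun n s => ((φn n s : ℝ) : EReal))) (hφ0 : φ 0 = ⊤) (C : ℝ) :
    ∃ δ > 0, ∀ᶠ n in atTop, ∀ s, |s| ≤ δ → C ≤ φn n s := by
  have h1 := tendsto_prod_of_forall_seq (F := fun n s => ((φn n s : ℝ) : EReal)) fun s hs => h.tendsto s 0 hs
  rw [hφ0] at h1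
  obtain ⟨P, hP, Q, hQ, hPQ⟩ := eventually_prod_iff.1
    (h1.eventually (eventually_gt_nhds (EReal.coe_lt_top C)))
  obtain ⟨δ, hδ, hQδ⟩ := Metric.eventually_nhds_iff.1 hQ
  refine ⟨δ / 2, by positivity, hP.mono fun n hn s hs => ?_⟩
  have := hPQ hn (hQδ (y := s) (by rw [Real.dist_eq, sub_zero]; linarith))
  exact (EReal.coe_lt_coe_iff.1 this).le

/-- Near each nonzero point the limit is below a finite bound, hence so are the approximants
eventually; compactness leaves finitely many neighbourhoods. -/
theorem IsReasonableApprox.exists_upper_bound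
    (h : IsReasonableApprox φ (fun n s => ((φn n s : ℝ) : EReal))) (hφ : IsAdmissible φ)
    {K : Set ℝ} (hK : IsCompact K) (hK0 : (0 : ℝ) ∉ K) :
    ∃ B : ℝ, ∀ᶠ n in atTop, ∀ s ∈ K, φn n s ≤ B := by
  refine hK.induction_on (p := fun S => ∃ B : ℝ, ∀ᶠ n in atTop, ∀ s ∈ S, φn n s ≤ B)
    ⟨0, by simp⟩ ?_ ?_ ?_
  · rintro S T hST ⟨B, hB⟩
    exact ⟨B, hB.mono fun n hn s hs => hn s (hST hs)⟩
  · rintro S T ⟨B, hB⟩ ⟨B', hB'⟩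
    refine ⟨max B B', (hB.and hB').mono ?_⟩
    rintro n ⟨h1, h2⟩ s (hs | hs)
    · exact (h1 s hs).trans (le_max_left _ _)
    · exact (h2 s hs).trans (le_max_right _ _)
  · intro t ht
    obtain ⟨B, hB⟩ := EReal.lt_iff_exists_real_btwn.1 (hφ.lt_top t fun h0 => hK0 (h0 ▸ ht))
    have h1 := tendsto_prod_of_forall_seq (F := fun n s => ((φn n s : ℝ) : EReal)) fun s hs => h.tendsto s t hs
    obtain ⟨P, hP, Q, hQ, hPQ⟩ := eventually_prod_iff.1
      (h1.eventually (eventually_lt_nhds hB.1))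
    exact ⟨{s | Q s}, mem_nhdsWithin_of_mem_nhds hQ, B,
      hP.mono fun n hn s hs => (EReal.coe_lt_coe_iff.1 (hPQ hn hs)).le⟩

/-- For data bounded by `M`, all classical weak solutions of the approximating problems are
uniformly small. -/
theorem IsReasonableApprox.eventually_abs_le {L : ℝ} (hL : 0 < L) {a : Linf L} (ha : IsElliptic a)
    (h : IsReasonableApprox φ (fun n s => ((φn n s : ℝ) : EReal))) (hφ : IsAdmissible φ)
    (hφ0 : φ 0 = ⊤) (M : ℝ) {ε : ℝ} (hε : 0 < ε) :
    ∀ᶠ n in atTop, ∀ g : L2 L, (∀ᵐ x ∂(volume.restrict (Ioo 0 L)), |g x| ≤ M) →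
      ∀ u : H10 L, IsClassicalWeakSolution a g (φn n) u →
        ∀ᵐ x ∂(volume.restrict (Ioo 0 L)), |u.toL2 x| ≤ ε := by
  obtain ⟨α, β, hα, -, hab⟩ := ha
  obtain ⟨B, hB⟩ := h.exists_upper_bound hφ
    (K := Icc (ε / 2) ε ∪ Icc (-ε) (-(ε / 2))) (isCompact_Icc.union isCompact_Icc) (by
      rintro (h0 | h0) <;> linarith [h0.1, h0.2])
  -- This is `C + M + 1` for `C = B + M`, which forces `c < -(B + M)`.
  obtain ⟨δ, hδ, hC⟩ := h.exists_lower_bound hφ0 (B + M + M + 1)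
  filter_upwards [hB, hC] with n hBn hCn g hg u hu
  obtain ⟨c, hc⟩ := (isClassicalWeakSolution_iff hL).1 hu
  refine H10.abs_le_of_const_small hL hα (hab.mono fun x hx => hx.1) hg hc hε (B := B)
    (fun s hs => hBn s ?_) (H10.const_lt_of_large_near_zero hL hα hab hg hc hδ hCn).le
  rcases le_or_gt 0 s with h0 | h0
  · rw [abs_of_nonneg h0] at hs
    exact Or.inl hs
  · rw [abs_of_neg h0] at hs
    exact Or.inr ⟨by linarith [hs.2], by linarith [hs.1]⟩

end Approximation

/-! ### Weak convergence -/

/-- A sequence that is bounded in `H^1_0(0, L)` and tends to zero uniformly tends to zero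
weakly. -/
theorem H10.tendsto_toWeakSpace_zero {L : ℝ} {U : ℕ → H10 L} {C : ℝ} (hC : ∀ j, ‖U j‖ ≤ C)
    (hU : ∀ ε > 0, ∀ᶠ j in atTop, ∀ᵐ x ∂(volume.restrict (Ioo 0 L)), |(U j).toL2 x| ≤ ε) :
    Tendsto (fun j => toWeakSpace ℝ (H10 L) (U j)) atTop (𝓝 0) := by
  have hC0 : 0 ≤ C := (norm_nonneg _).trans (hC 0)
  let e : TestFn L → L2 L := fun ψ => ψ.memLp_two.toLp _
  -- convergence against test functions
  have h1 : ∀ ψ : TestFn L, Tendsto (fun j => inner ℝ (e ψ) (U j).deriv) atTop (𝓝 0) := by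
    intro ψ
    have hi : Integrable (fun x => |_root_.deriv ψ x|) (volume.restrict (Ioo 0 L)) :=
      (ψ.memLp_two_deriv.integrable (by norm_num)).abs
    have hin : ∀ j, inner ℝ (e ψ) (U j).deriv
        = -∫ x in Ioo 0 L, (U j).toL2 x * _root_.deriv ψ x := fun j => by
      rw [(U j).isWeakDeriv ψ, neg_neg, L2.inner_def]
      refine integral_congr_ae ?_
      filter_upwards [ψ.memLp_two.coeFn_toLp] with x hx
      rw [hx]
      simp
    rw [Metric.tendsto_nhds]
    intro ε hε
    set K := ∫ x in Ioo 0 L, |_root_.deriv ψ x| with hK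
    have hK0 : 0 ≤ K := integral_nonneg fun _ => abs_nonneg _
    filter_upwards [hU (ε / (K + 1)) (by positivity)] with j hj
    rw [Real.dist_eq, sub_zero, hin, abs_neg]
    calc |∫ x in Ioo 0 L, (U j).toL2 x * _root_.deriv ψ x|
        ≤ ∫ x in Ioo 0 L, ε / (K + 1) * |_root_.deriv ψ x| := by
          rw [← Real.norm_eq_abs]
          refine norm_integral_le_of_norm_le (hi.const_mul _) ?_
          filter_upwards [hj] with x hx
          rw [norm_mul]
          exact mul_le_mul_of_nonneg_right hx (abs_nonneg _)
      _ = ε * (K / (K + 1)) := by rw [integral_const_mul, ← hK]; ring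
      _ < ε * 1 := by
          refine mul_lt_mul_of_pos_left ?_ hε
          rw [div_lt_one (by positivity)]
          linarith
      _ = ε := mul_one _
  -- test functions are dense
  have hdense : (Submodule.span ℝ (range e)).topologicalClosure = ⊤ := by
    rw [Submodule.topologicalClosure_eq_top_iff, Submodule.eq_bot_iff]
    intro h hh
    have hae : ∀ᵐ x ∂(volume : Measure ℝ), x ∈ Ioo 0 L → h x = 0 := by
      refine isOpen_Ioo.ae_eq_zero_of_integral_contDiff_smul_eq_zero
        (IntegrableOn.locallyIntegrableOn (L2.integrable h)) fun χ hχ hχc hχt => ?_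
      let ψ : TestFn L := ⟨χ, hχ, hχc, hχt⟩
      have h2 := (Submodule.mem_orthogonal _ _).1 hh (e ψ) (Submodule.subset_span ⟨ψ, rfl⟩)
      rw [L2.inner_def] at h2
      rw [← setIntegral_eq_integral_of_forall_compl_eq_zero (s := Ioo 0 L) fun x hx => by
        rw [image_eq_zero_of_notMem_tsupport fun hm => hx (hχt hm), zero_smul]]
      refine Eq.trans (integral_congr_ae ?_) h2
      filter_upwards [ψ.memLp_two.coeFn_toLp] with x hx
      rw [hx]
      simp only [smul_eq_mul, RCLike.inner_apply, conj_trivial]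
      exact mul_comm _ _
    apply Lp.ext
    refine EventuallyEq.trans ?_ (Lp.coeFn_zero _ _ _).symm
    exact (ae_restrict_iff' measurableSet_Ioo).2 hae
  have h2 : ∀ p ∈ Submodule.span ℝ (range e),
      Tendsto (fun j => inner ℝ p (U j).deriv) atTop (𝓝 0) := by
    intro p hp
    induction hp using Submodule.span_induction with
    | mem x hx => obtain ⟨ψ, rfl⟩ := hx; exact h1 ψ
    | zero => simp
    | add x y _ _ hx hy => simpa [inner_add_left] using hx.add hy
    | smul r x _ hx => simpa [inner_smul_left] using hx.const_mul r
  have h3 : ∀ h : L2 L, Tendsto (fun j => inner ℝ h (U j).deriv) atTop (𝓝 0) := by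
    intro h
    rw [Metric.tendsto_nhds]
    intro ε hε
    have hmem : h ∈ closure (Submodule.span ℝ (range e) : Set (L2 L)) := by
      rw [← Submodule.topologicalClosure_coe, hdense]
      trivial
    obtain ⟨p, hp, hpd⟩ := Metric.mem_closure_iff.1 hmem (ε / 2 / (C + 1)) (by positivity)
    filter_upwards [Metric.tendsto_nhds.1 (h2 p hp) (ε / 2) (by positivity)] with j hj
    rw [Real.dist_eq, sub_zero] at hj ⊢
    have e1 : inner ℝ h (U j).deriv = inner ℝ (h - p) (U j).deriv + inner ℝ p (U j).deriv := by
      rw [inner_sub_left]; ring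
    have e2 : |inner ℝ (h - p) (U j).deriv| ≤ ε / 2 := by
      refine (abs_real_inner_le_norm _ _).trans ?_
      rw [dist_eq_norm, lt_div_iff₀ (by positivity)] at hpd
      have := mul_le_mul_of_nonneg_left ((hC j).trans (by linarith : C ≤ C + 1)) (norm_nonneg (h - p))
      rw [H10.norm_eq] at this
      linarith
    rw [e1]
    exact (abs_add_le _ _).trans_lt (by linarith)
  have hind : IsInducing (fun (x : WeakSpace ℝ (H10 L)) (ℓ : H10 L →L[ℝ] ℝ) =>
      (topDualPairing ℝ (H10 L)).flip x ℓ) := ⟨rfl⟩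
  rw [hind.tendsto_nhds_iff, tendsto_pi_nhds]
  intro ℓ
  let D : H10 L →ₗᵢ[ℝ] L2 L := ⟨H10.deriv, fun _ => rfl⟩
  -- Differentiation embeds `H^1_0` isometrically in `L²`. Hahn–Banach extends the functional from
  -- the range and Riesz represents it, so `h3` applies.
  obtain ⟨G, hG, -⟩ := exists_extension_norm_eq D.toLinearMap.range
    (ℓ.comp (D.equivRange.symm.toContinuousLinearEquiv : _ →L[ℝ] H10 L))
  have hGℓ : ∀ j, ℓ (U j) = inner ℝ ((InnerProductSpace.toDual ℝ (L2 L)).symm G) (U j).deriv :=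
    fun j => by
      rw [InnerProductSpace.toDual_symm_apply]
      have := hG (D.equivRange (U j))
      simp only [ContinuousLinearMap.comp_apply] at this
      refine Eq.trans ?_ this.symm
      exact congrArg ℓ (D.equivRange.symm_apply_apply (U j)).symm
  have := h3 ((InnerProductSpace.toDual ℝ (L2 L)).symm G)
  simp only [← hGℓ] at this
  have h0 : (topDualPairing ℝ (H10 L)).flip (0 : H10 L) ℓ = 0 := by simp
  change Tendsto (fun j => ℓ (U j)) atTop (𝓝 ((topDualPairing ℝ (H10 L)).flip (0 : H10 L) ℓ))
  rw [h0]
  exact this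

/-! ### Approximation of the data and existence by Euler's scheme -/

theorem exists_bounded_L2_near {L : ℝ} (g : L2 L) {ε : ℝ} (hε : 0 < ε) :
    ∃ (g' : L2 L) (M : ℝ), (∀ᵐ x ∂(volume.restrict (Ioo 0 L)), |g' x| ≤ M) ∧ ‖g' - g‖ ≤ ε := by
  obtain ⟨f, hf, hfm⟩ := (Lp.memLp g).exists_boundedContinuous_eLpNorm_sub_le (by norm_num)
    (ε := ENNReal.ofReal ε) (by simpa using hε)
  refine ⟨hfm.toLp _, ‖f‖, ?_, ?_⟩
  · filter_upwards [hfm.coeFn_toLp] with x hx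
    rw [hx]
    exact f.norm_coe_le_norm x
  · rw [norm_sub_rev, ← Lp.toLp_coeFn g (Lp.memLp g), ← MemLp.toLp_sub, Lp.norm_toLp]
    exact ENNReal.toReal_le_of_le_ofReal hε.le hf

theorem L2.norm_le_of_ae_abs_le {L : ℝ} {g : L2 L} {η : ℝ}
    (hη : 0 ≤ η) (h : ∀ᵐ x ∂(volume.restrict (Ioo 0 L)), |g x| ≤ η) :
    ‖g‖ ≤ measureUnivNNReal (volume.restrict (Ioo 0 L)) ^ (2 : ℝ)⁻¹ * η := by
  have := Lp.norm_le_of_ae_bound (f := g) hη h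
  simpa using this

/-- The explicit Euler scheme for the equation `dw = (φ(w) + c) dP + dQ`, where `p` and `q` are
the values of `P` and `Q` at the nodes. -/
noncomputable def eulerSeq (φ : ℝ →ᵇ ℝ) (p q : ℕ → ℝ) (c : ℝ) : ℕ → ℝ
  | 0 => 0
  | i + 1 => eulerSeq φ p q c i + (φ (eulerSeq φ p q c i) + c) * (p (i + 1) - p i)
      + (q (i + 1) - q i)

theorem continuous_eulerSeq (φ : ℝ →ᵇ ℝ) (p q : ℕ → ℝ) (i : ℕ) :
    Continuous fun c => eulerSeq φ p q c i := by
  induction i with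
  | zero => exact continuous_const
  | succ i ih =>
    have := φ.continuous.comp ih
    exact (ih.add ((this.add continuous_id).mul continuous_const)).add continuous_const

/-- Replacing `φ` by `±‖φ‖` in the scheme bounds each step, since `p` is nondecreasing. These bounds
give both the signs needed for shooting and a bound on the nodes. -/
theorem eulerSeq_mem_Icc (φ : ℝ →ᵇ ℝ) {p q : ℕ → ℝ} (hp0 : p 0 = 0) (hq0 : q 0 = 0) (c : ℝ)
    {N : ℕ} (hp : ∀ i < N, p i ≤ p (i + 1)) {i : ℕ} (hi : i ≤ N) :
    eulerSeq φ p q c i ∈ Icc ((c - ‖φ‖) * p i + q i) ((c + ‖φ‖) * p i + q i) := by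
  induction i with
  | zero => simp [eulerSeq, hp0, hq0]
  | succ i ih =>
    obtain ⟨h1, h2⟩ := ih (by omega)
    have h3 := hp i (by omega)
    obtain ⟨h4, h5⟩ := abs_le.1 (φ.norm_coe_le_norm (eulerSeq φ p q c i))
    simp only [eulerSeq]
    constructor <;> nlinarith

theorem primitive_mono {L : ℝ} {b : ℝ → ℝ} (hb : IntervalIntegrable b volume 0 L)
    (hbpos : ∀ᵐ x ∂(volume.restrict (Ioo 0 L)), 0 < b x) {x y : ℝ} (hx : 0 ≤ x) (hxy : x ≤ y)
    (hy : y ≤ L) : ∫ t in (0 : ℝ)..x, b t ≤ ∫ t in (0 : ℝ)..y, b t := by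
  have hsub : ∀ z ∈ Icc 0 L, IntervalIntegrable b volume 0 z := fun z hz => hb.mono_set (by
    rw [uIcc_of_le hz.1, uIcc_of_le (hz.1.trans hz.2)]; exact Icc_subset_Icc_right hz.2)
  rw [← sub_nonneg, intervalIntegral.integral_interval_sub_left (hsub y ⟨hx.trans hxy, hy⟩)
    (hsub x ⟨hx, hxy.trans hy⟩), intervalIntegral.integral_of_le hxy, integral_Ioc_eq_integral_Ioo]
  refine integral_nonneg_of_ae ?_
  filter_upwards [ae_restrict_of_ae_restrict_of_subset (Ioo_subset_Ioo hx hy) hbpos] with t ht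
    using ht.le

/-- For `w` as in the Euler scheme with step `h`, the primitive of the piecewise equation
interpolates the scheme. -/
theorem primitive_eulerSeq {L : ℝ} {b q : ℝ → ℝ} (hb : IntervalIntegrable b volume 0 L)
    (hq : IntervalIntegrable q volume 0 L) (φ : ℝ →ᵇ ℝ) (c : ℝ) {h : ℝ} (hh : 0 < h) {N : ℕ}
    (hN : N * h = L) {W : ℕ → ℝ}
    (hW : W = eulerSeq φ (fun i => ∫ t in (0 : ℝ)..(i * h), b t)
      (fun i => ∫ t in (0 : ℝ)..(i * h), q t) c)
    (hv : IntervalIntegrable (fun t => (φ (W ⌊t / h⌋₊) + c) * b t + q t) volume 0 L)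
    {i : ℕ} (hi : i ≤ N) :
    ∫ t in (0 : ℝ)..(i * h), ((φ (W ⌊t / h⌋₊) + c) * b t + q t) = W i ∧
    (i < N → ∀ x ∈ Icc (i * h) ((i + 1) * h),
      ∫ t in (0 : ℝ)..x, ((φ (W ⌊t / h⌋₊) + c) * b t + q t) = W i +
        (φ (W i) + c) * ((∫ t in (0 : ℝ)..x, b t) - ∫ t in (0 : ℝ)..(i * h), b t) +
        ((∫ t in (0 : ℝ)..x, q t) - ∫ t in (0 : ℝ)..(i * h), q t)) := by
  have hsub : ∀ {f : ℝ → ℝ}, IntervalIntegrable f volume 0 L → ∀ x ∈ Icc 0 L, ∀ y ∈ Icc 0 L,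
      IntervalIntegrable f volume x y := fun hf x hx y hy => hf.mono_set (by
    rw [uIcc_of_le (hx.1.trans hx.2)]
    exact uIcc_subset_Icc hx hy)
  have step : ∀ i < N, ∀ x ∈ Icc ((i : ℝ) * h) ((i + 1) * h),
      ∫ t in (0 : ℝ)..x, ((φ (W ⌊t / h⌋₊) + c) * b t + q t) =
        (∫ t in (0 : ℝ)..(i * h), ((φ (W ⌊t / h⌋₊) + c) * b t + q t)) +
        (φ (W i) + c) * ((∫ t in (0 : ℝ)..x, b t) - ∫ t in (0 : ℝ)..(i * h), b t) +
        ((∫ t in (0 : ℝ)..x, q t) - ∫ t in (0 : ℝ)..(i * h), q t) := by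
    intro i hi x hx
    have hi' : ((i : ℝ) + 1) * h ≤ L := by
      rw [← hN]
      exact mul_le_mul_of_nonneg_right (by exact_mod_cast hi) hh.le
    have hi0 : 0 ≤ (i : ℝ) * h := by positivity
    have m0 : (0 : ℝ) ∈ Icc 0 L := ⟨le_rfl, hi0.trans (hx.1.trans (hx.2.trans hi'))⟩
    have mi : (i : ℝ) * h ∈ Icc 0 L := ⟨hi0, hx.1.trans (hx.2.trans hi')⟩
    have mx : x ∈ Icc 0 L := ⟨hi0.trans hx.1, hx.2.trans hi'⟩
    rw [intervalIntegral.integral_interval_sub_left (hsub hb _ m0 _ mx) (hsub hb _ m0 _ mi),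
      intervalIntegral.integral_interval_sub_left (hsub hq _ m0 _ mx) (hsub hq _ m0 _ mi),
      ← intervalIntegral.integral_add_adjacent_intervals (hsub hv _ m0 _ mi) (hsub hv _ mi _ mx),
      add_assoc, ← intervalIntegral.integral_const_mul,
      ← intervalIntegral.integral_add ((hsub hb _ mi _ mx).const_mul _) (hsub hq _ mi _ mx)]
    congr 1
    rw [intervalIntegral.integral_of_le hx.1, intervalIntegral.integral_of_le hx.1,
      integral_Ioc_eq_integral_Ioo, integral_Ioc_eq_integral_Ioo]
    refine setIntegral_congr_fun measurableSet_Ioo fun t ht => ?_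
    have hf : ⌊t / h⌋₊ = i := by
      rw [Nat.floor_eq_iff (div_nonneg (hi0.trans ht.1.le) hh.le), le_div_iff₀ hh, div_lt_iff₀ hh]
      exact ⟨ht.1.le, ht.2.trans_le hx.2⟩
    simp only [hf]
  have hnode : ∀ i ≤ N,
      ∫ t in (0 : ℝ)..(i * h), ((φ (W ⌊t / h⌋₊) + c) * b t + q t) = W i := by
    intro i hi
    induction i with
    | zero => simp [hW, eulerSeq]
    | succ i ih =>
      have := step i hi ((i + 1 : ℕ) * h)
        ⟨mul_le_mul_of_nonneg_right (by push_cast; linarith) hh.le, by push_cast; exact le_rfl⟩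
      rw [ih (by omega)] at this
      rw [this]
      simp only [hW, eulerSeq]
  exact ⟨hnode i hi, fun hi' x hx => by rw [step i hi' x hx, hnode i hi]⟩

/-- Approximate solvability of the boundary value problem
`w' = (φ(w) + c) b + q`, `w(0) = w(L) = 0`, with unknown constant `c`. -/
theorem exists_approx_solution {L : ℝ} (hL : 0 < L) {b q : ℝ → ℝ}
    (hb : IntervalIntegrable b volume 0 L) (hq : IntervalIntegrable q volume 0 L)
    (hbpos : ∀ᵐ x ∂(volume.restrict (Ioo 0 L)), 0 < b x) (φ : ℝ →ᵇ ℝ) {η : ℝ} (hη : 0 < η) :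
    ∃ (c : ℝ) (s : ℝ → ℝ), Measurable s ∧
      ∫ t in (0 : ℝ)..L, ((φ (s t) + c) * b t + q t) = 0 ∧
      ∀ x ∈ Ioo 0 L, |φ (s x) - φ (∫ t in (0 : ℝ)..x, ((φ (s t) + c) * b t + q t))| ≤ η := by
  let P : ℝ → ℝ := fun x => ∫ t in (0 : ℝ)..x, b t
  let Q : ℝ → ℝ := fun x => ∫ t in (0 : ℝ)..x, q t
  have hP : ContinuousOn P (Icc 0 L) := continuousOn_primitive_Icc hL hb
  have hQ : ContinuousOn Q (Icc 0 L) := continuousOn_primitive_Icc hL hq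
  have hP0 : P 0 = 0 := intervalIntegral.integral_same
  have hQ0 : Q 0 = 0 := intervalIntegral.integral_same
  have hPmono : ∀ {x y : ℝ}, 0 ≤ x → x ≤ y → y ≤ L → P x ≤ P y := fun hx hxy hy =>
    primitive_mono hb hbpos hx hxy hy
  have hPL : 0 < P L := by
    have h1 : 0 < ∫ x in Ioo 0 L, b x := by
      rw [integral_pos_iff_support_of_nonneg_ae (hbpos.mono fun x hx => hx.le)
        ((intervalIntegrable_iff_integrableOn_Ioo_of_le hL.le).1 hb)]
      have h2 : (volume.restrict (Ioo 0 L)) (Function.support b) = volume.restrict (Ioo 0 L) univ :=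
        measure_congr (by
          filter_upwards [hbpos] with x hx
          exact propext ⟨fun _ => trivial, fun _ => hx.ne'⟩)
      rw [h2]
      simpa using hL
    rwa [← intervalIntegral_eq_setIntegral_Ioo hL] at h1
  obtain ⟨Qm, hQm⟩ := isCompact_Icc.exists_bound_of_continuousOn hQ
  have hφ0 := norm_nonneg φ
  -- With this `C`, the final node is nonpositive for `c = -C` and nonnegative for `c = C`. All
  -- nodes with `|c| ≤ C` then lie in `[-R, R]`.
  set C : ℝ := ‖φ‖ + |Q L| / P L with hC
  have hC0 : 0 ≤ C := by positivity
  set R : ℝ := (C + ‖φ‖) * P L + Qm with hR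
  obtain ⟨δ, hδ, hδφ⟩ := Metric.uniformContinuousOn_iff.1
    ((isCompact_Icc (a := -(R + 1)) (b := R + 1)).uniformContinuousOn_of_continuous
      φ.continuous.continuousOn) η hη
  -- On one cell the solution moves by at most `(C + ‖φ‖ + 1) * τ`, strictly less than `min δ 1`.
  -- The `1` keeps it in `[-(R + 1), R + 1]`, where `δ` controls the oscillation of `φ`.
  set τ : ℝ := min δ 1 / (C + ‖φ‖ + 2) with hτ
  have hτ0 : 0 < τ := div_pos (lt_min hδ one_pos) (by positivity)
  obtain ⟨δP, hδP, hPδ⟩ := Metric.uniformContinuousOn_iff.1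
    (isCompact_Icc.uniformContinuousOn_of_continuous hP) τ hτ0
  obtain ⟨δQ, hδQ, hQδ⟩ := Metric.uniformContinuousOn_iff.1
    (isCompact_Icc.uniformContinuousOn_of_continuous hQ) τ hτ0
  obtain ⟨n, hn⟩ := exists_nat_gt (L / min δP δQ)
  set N : ℕ := n + 1 with hNdef
  have hNpos : (0 : ℝ) < N := by positivity
  set h : ℝ := L / N with hh
  have hh0 : 0 < h := by positivity
  have hNh : N * h = L := by rw [hh]; field_simp
  have hhδ : h < min δP δQ := by
    rw [hh, div_lt_iff₀ hNpos]
    rw [div_lt_iff₀ (lt_min hδP hδQ)] at hn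
    have : (n : ℝ) ≤ N := by rw [hNdef]; push_cast; linarith
    nlinarith [lt_min hδP hδQ]
  let p : ℕ → ℝ := fun i => P (i * h)
  let r : ℕ → ℝ := fun i => Q (i * h)
  have hp0 : p 0 = 0 := by simp [p, hP0]
  have hr0 : r 0 = 0 := by simp [r, hQ0]
  have hpN : p N = P L := by simp only [p, hNh]
  have hrN : r N = Q L := by simp only [r, hNh]
  have hnode : ∀ i ≤ N, (i : ℝ) * h ∈ Icc 0 L := fun i hi =>
    ⟨by positivity, by rw [← hNh]; exact mul_le_mul_of_nonneg_right (by exact_mod_cast hi) hh0.le⟩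
  have hpm : ∀ i < N, p i ≤ p (i + 1) := fun i hi =>
    hPmono (hnode i hi.le).1 (mul_le_mul_of_nonneg_right (by push_cast; linarith) hh0.le)
      (hnode (i + 1) hi).2
  have hQP : |Q L| / P L * P L = |Q L| := div_mul_cancel₀ _ hPL.ne'
  -- Shooting: the final node depends continuously on `c`, so the intermediate value theorem meets
  -- the right boundary condition.
  obtain ⟨c, hc, hcN⟩ : ∃ c ∈ Icc (-C) C, eulerSeq φ p r c N = 0 := by
    refine intermediate_value_Icc (by linarith) (continuous_eulerSeq φ p r N).continuousOn
      ⟨?_, ?_⟩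
    · refine (eulerSeq_mem_Icc φ hp0 hr0 (-C) hpm le_rfl).2.trans ?_
      rw [hpN, hrN, hC]
      nlinarith [le_abs_self (Q L)]
    · refine le_trans ?_ (eulerSeq_mem_Icc φ hp0 hr0 C hpm le_rfl).1
      rw [hpN, hrN, hC]
      nlinarith [neg_abs_le (Q L)]
  set W : ℕ → ℝ := eulerSeq φ p r c with hW
  have hs : Measurable fun t : ℝ => W ⌊t / h⌋₊ :=
    (measurable_from_nat (f := W)).comp (Nat.measurable_floor.comp (measurable_id.div_const h))
  have hv : IntervalIntegrable (fun t => (φ (W ⌊t / h⌋₊) + c) * b t + q t) volume 0 L := by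
    rw [intervalIntegrable_iff_integrableOn_Ioo_of_le hL.le] at hb hq ⊢
    refine Integrable.add ?_ hq
    refine hb.bdd_mul (c := ‖φ‖ + |c|)
      ((φ.continuous.measurable.comp hs).add_const c).aestronglyMeasurable (ae_of_all _ fun x => ?_)
    exact (norm_add_le _ _).trans (add_le_add (φ.norm_coe_le_norm _) le_rfl)
  refine ⟨c, fun t => W ⌊t / h⌋₊, hs, ?_, fun x hx => ?_⟩
  · have := (primitive_eulerSeq hb hq φ c hh0 hNh rfl hv le_rfl).1
    rw [hNh] at this
    rw [this]
    exact hcN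
  · set i := ⌊x / h⌋₊ with hi
    obtain ⟨hi1, hi2⟩ := (Nat.floor_eq_iff (div_nonneg hx.1.le hh0.le)).1 hi.symm
    rw [le_div_iff₀ hh0] at hi1
    rw [div_lt_iff₀ hh0] at hi2
    have hiN : i < N := by
      have : (i : ℝ) < N := by
        by_contra! hn
        have := mul_le_mul_of_nonneg_right hn hh0.le
        linarith [hx.2]
      exact_mod_cast this
    have hwx := (primitive_eulerSeq hb hq φ c hh0 hNh rfl hv hiN.le).2 hiN x ⟨hi1, hi2.le⟩
    have hdist : dist x (i * h) < min δP δQ := by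
      rw [Real.dist_eq, abs_of_nonneg (by linarith)]
      linarith
    have mi := hnode i hiN.le
    have mx : x ∈ Icc 0 L := Ioo_subset_Icc_self hx
    have d1 := hPδ x mx _ mi (hdist.trans_le (min_le_left _ _))
    have d2 := hQδ x mx _ mi (hdist.trans_le (min_le_right _ _))
    rw [Real.dist_eq] at d1 d2
    obtain ⟨w1, w2⟩ := eulerSeq_mem_Icc φ hp0 hr0 c hpm hiN.le
    have hWi : |W i| ≤ R := by
      have e1 : p i ≤ P L := hPmono mi.1 mi.2 le_rfl
      have e2 : 0 ≤ p i := hP0 ▸ hPmono le_rfl mi.1 mi.2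
      obtain ⟨e3, e4⟩ := abs_le.1 (hQm _ mi)
      have e5 : (C + ‖φ‖) * p i ≤ (C + ‖φ‖) * P L := mul_le_mul_of_nonneg_left e1 (by positivity)
      have e6 : (c + ‖φ‖) * p i ≤ (C + ‖φ‖) * p i := mul_le_mul_of_nonneg_right (by linarith [hc.2]) e2
      have e7 : (-C - ‖φ‖) * p i ≤ (c - ‖φ‖) * p i := mul_le_mul_of_nonneg_right (by linarith [hc.1]) e2
      change -Qm ≤ r i at e3
      change r i ≤ Qm at e4
      rw [abs_le, hR]
      constructor <;> linarith
    have hcφ : |φ (W i) + c| ≤ C + ‖φ‖ := by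
      refine (abs_add_le _ _).trans ?_
      have := φ.norm_coe_le_norm (W i)
      rw [Real.norm_eq_abs] at this
      linarith [abs_le.2 hc]
    set w := ∫ t in (0 : ℝ)..x, ((φ (W ⌊t / h⌋₊) + c) * b t + q t) with hw
    have hdiff : |w - W i| < min δ 1 := by
      have e : w - W i = (φ (W i) + c) * (P x - P (i * h)) + (Q x - Q (i * h)) := by
        rw [hwx]
        simp only [P, Q, hW, p, r]
        ring
      rw [e]
      calc |(φ (W i) + c) * (P x - P (i * h)) + (Q x - Q (i * h))|
          ≤ |φ (W i) + c| * |P x - P (i * h)| + |Q x - Q (i * h)| := by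
            rw [← abs_mul]; exact abs_add_le _ _
        _ ≤ (C + ‖φ‖) * τ + τ := by
            gcongr
        _ < (C + ‖φ‖ + 2) * τ := by linarith
        _ = min δ 1 := by rw [hτ]; field_simp
    have hW' := abs_le.1 hWi
    have hd' := abs_lt.1 (hdiff.trans_le (min_le_right _ _))
    have := hδφ (W i) ⟨by linarith, by linarith⟩ w ⟨by linarith, by linarith⟩ (by
      rw [dist_comm, Real.dist_eq]; exact hdiff.trans_le (min_le_left _ _))
    exact this.le

/-- Up to an arbitrarily small bounded perturbation of `g`, the problem with a bounded continuous
nonlinearity has a classical weak solution. -/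
theorem exists_isClassicalWeakSolution_near {L : ℝ} (hL : 0 < L) {a : Linf L} (ha : IsElliptic a)
    (g : L2 L) (φ : ℝ →ᵇ ℝ) {η : ℝ} (hη : 0 < η) :
    ∃ G : L2 L, (∀ᵐ x ∂(volume.restrict (Ioo 0 L)), |G x - g x| ≤ η) ∧
      ∃ u : H10 L, IsClassicalWeakSolution a G φ u := by
  obtain ⟨α, β, hα, -, hab⟩ := ha
  have hbt : MemLp (fun x => (a x)⁻¹) ⊤ (volume.restrict (Ioo 0 L)) := by
    refine memLp_top_of_bound (Lp.aestronglyMeasurable a).aemeasurable.inv.aestronglyMeasurable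
      α⁻¹ ?_
    filter_upwards [hab] with x hx
    rw [norm_inv]
    exact inv_anti₀ hα (hx.1.trans (le_abs_self _))
  have hq2 : MemLp (fun x => g x * (a x)⁻¹) 2 (volume.restrict (Ioo 0 L)) := hbt.mul (Lp.memLp g)
  have hb2 : MemLp (fun x => (a x)⁻¹) 2 (volume.restrict (Ioo 0 L)) := hbt.mono_exponent le_top
  have hii : ∀ {f : ℝ → ℝ}, MemLp f 2 (volume.restrict (Ioo 0 L)) →
      IntervalIntegrable f volume 0 L := fun hf =>
    (intervalIntegrable_iff_integrableOn_Ioo_of_le hL.le).2 (hf.integrable (by norm_num))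
  obtain ⟨c, s, hs, h0, hsφ⟩ := exists_approx_solution hL (hii hb2) (hii hq2)
    (hab.mono fun x hx => inv_pos.2 (hα.trans_le hx.1)) φ hη
  have hφs : MemLp (fun x => φ (s x)) 2 (volume.restrict (Ioo 0 L)) :=
    MemLp.of_bound (φ.continuous.measurable.comp hs).aestronglyMeasurable ‖φ‖
      (ae_of_all _ fun _ => φ.norm_coe_le_norm _)
  have hv : MemLp (fun x => (φ (s x) + c) * (a x)⁻¹ + g x * (a x)⁻¹) 2
      (volume.restrict (Ioo 0 L)) :=
    (hbt.mul (hφs.add (memLp_const c))).add hq2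
  have hcongr : ∀ x ∈ Icc 0 L, ∫ t in (0 : ℝ)..x, hv.toLp _ t
      = ∫ t in (0 : ℝ)..x, ((φ (s t) + c) * (a t)⁻¹ + g t * (a t)⁻¹) := fun x hx => by
    rw [intervalIntegral.integral_of_le hx.1, intervalIntegral.integral_of_le hx.1,
      integral_Ioc_eq_integral_Ioo, integral_Ioc_eq_integral_Ioo]
    exact integral_congr_ae (ae_restrict_of_ae_restrict_of_subset (Ioo_subset_Ioo_right hx.2)
      hv.coeFn_toLp)
  obtain ⟨u, hu⟩ := H10.exists_deriv_eq hL (hv.toLp _)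
    ((hcongr L ⟨hL.le, le_rfl⟩).trans h0)
  -- The scheme gives `a u' = φ(s) + g + c`; moving `φ(s) - φ(u)` into the datum makes `u` an exact
  -- solution.
  have hG : MemLp (fun x => g x + (φ (s x) - φ (u.toL2 x))) 2 (volume.restrict (Ioo 0 L)) :=
    (Lp.memLp g).add (hφs.sub (φ.memLp_comp u.toL2))
  refine ⟨hG.toLp _, ?_, u, (isClassicalWeakSolution_iff hL).2 ⟨c, ?_⟩⟩
  · filter_upwards [hG.coeFn_toLp, (u.toL2_ae_eq_primitive hL).1,
      ae_restrict_mem measurableSet_Ioo] with x hx hux hxm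
    rw [hx, hux, hu, hcongr x (Ioo_subset_Icc_self hxm), add_sub_cancel_left]
    exact hsφ x hxm
  · rw [hu]
    filter_upwards [hG.coeFn_toLp, hv.coeFn_toLp, hab] with x hx hvx hax
    rw [hx, hvx]
    have : a x ≠ 0 := (hα.trans_le hax.1).ne'
    field_simp
    ring

/-! ### The diagonal choice of indices and data -/

theorem mainTheorem9 (L : ℝ) (hL : 0 < L) (a : Linf L) (ha : IsElliptic a) (g : L2 L)
    (φ : ℝ → EReal) (hφ : IsAdmissible φ) (hφ0 : φ 0 = ⊤)
    (hsol : ∃ u : H10 L, IsWeakSolution a g φ u)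
    (φn : ℕ → ℝ →ᵇ ℝ) (hφn : IsReasonableApprox φ (fun n s => ((φn n s : ℝ) : EReal))) :
    ∃ (k : ℕ → ℕ) (G : ℕ → L2 L), StrictMono k ∧ Tendsto G atTop (𝓝 g) ∧
      (∀ j, ∃ u : H10 L, IsClassicalWeakSolution a (G j) (φn (k j)) u) ∧
      ∀ U : ℕ → H10 L, (∀ j, IsClassicalWeakSolution a (G j) (φn (k j)) (U j)) →
        Tendsto (fun j => toWeakSpace ℝ (H10 L) (U j)) atTop (𝓝 0) := by
  have hε : ∀ j : ℕ, (0 : ℝ) < 1 / ((j : ℝ) + 1) := fun j => by positivity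
  have hε0 : Tendsto (fun j : ℕ => 1 / ((j : ℝ) + 1)) atTop (𝓝 0) :=
    tendsto_one_div_add_atTop_nhds_zero_nat
  choose g' M hM hg' using fun j : ℕ => exists_bounded_L2_near g (hε j)
  -- The bounds `M j` need not be uniform in `j`. The threshold holds for every datum bounded by `M
  -- j + 1 / (j + 1)`, leaving room for the perturbation `G j`, which can only be built once `k j`
  -- is known.
  choose N hN using fun j : ℕ => eventually_atTop.1
    (hφn.eventually_abs_le hL ha hφ hφ0 (M j + 1 / ((j : ℝ) + 1)) (hε j))
  obtain ⟨k, hk, hkN⟩ : ∃ k : ℕ → ℕ, StrictMono k ∧ ∀ j, N j ≤ k j :=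
    extraction_forall_of_eventually fun j => eventually_ge_atTop (N j)
  choose G hG hGs using fun j : ℕ =>
    exists_isClassicalWeakSolution_near hL ha (g' j) (φn (k j)) (hε j)
  have hGM : ∀ j, ∀ᵐ x ∂(volume.restrict (Ioo 0 L)), |G j x| ≤ M j + 1 / ((j : ℝ) + 1) := by
    intro j
    filter_upwards [hM j, hG j] with x h1 h2
    have := abs_add_le (g' j x) (G j x - g' j x)
    rw [add_sub_cancel] at this
    linarith
  have hGg : Tendsto G atTop (𝓝 g) := by
    rw [tendsto_iff_norm_sub_tendsto_zero]
    set K : ℝ := measureUnivNNReal (volume.restrict (Ioo 0 L)) ^ (2 : ℝ)⁻¹ with hK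
    refine squeeze_zero (fun j => norm_nonneg _) (fun j => ?_)
      (by simpa only [mul_zero] using hε0.const_mul (K + 1))
    have h1 : ‖G j - g' j‖ ≤ K * (1 / ((j : ℝ) + 1)) := by
      refine L2.norm_le_of_ae_abs_le (hε j).le ?_
      filter_upwards [Lp.coeFn_sub (G j) (g' j), hG j] with x h1 h2
      rw [h1]
      exact h2
    have h2 := norm_add_le (G j - g' j) (g' j - g)
    rw [sub_add_sub_cancel] at h2
    linarith [hg' j]
  refine ⟨k, G, hk, hGg, hGs, fun U hU => ?_⟩
  -- The energy bound needs only `‖G j‖` bounded, which follows from convergence; smallness comes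
  -- from the choice of `k`.
  obtain ⟨α, β, hα, -, hab⟩ := id ha
  obtain ⟨C, hC⟩ := hGg.norm.bddAbove_range
  refine H10.tendsto_toWeakSpace_zero (C := C / α) (fun j => ?_) fun ε hε' => ?_
  · exact ((hU j).norm_le hL hα (hab.mono fun x hx => hx.1)).trans
      (div_le_div_of_nonneg_right (hC ⟨j, rfl⟩) hα.le)
  · filter_upwards [hε0.eventually (ge_mem_nhds hε')] with j hj
    exact (hN j (k j) (hkN j) (G j) (hGM j) (U j) (hU j)).mono fun x hx => hx.trans hj
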